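/- Let $\mathbb{k}$ be a field and let $\mathfrak{g}$ be a (right) Leibniz algebra over $\mathbb{k}$: a $\mathbb{k}$-vector space with a bilinear product satisfying $x(yz)=(xy)z-(xz)y$. Let $\mathfrak{g}_{\mathrm{Lie}}=\mathfrak{g}/\langle x^2 \mid x\in\mathfrak{g}\rangle_{\mathbb{k}}$, which is a Lie algebra with the induced product, write $\overline{x}$ for the image of $x$, and let $\mathrm{Mod}_{\mathfrak{g}_{\mathrm{Lie}}}$ be the category of right $\mathfrak{g}_{\mathrm{Lie}}$-modules. Let $\mathrm{Mod}_{\mathfrak{g}}$ be the category of $\mathfrak{g}$-modules: vector spaces $M$ with bilinear left and right actions of $\mathfrak{g}$ satisfying $m(xy)=(mx)y-(my)x$, $x(my)=(xm)y-(xy)m$ and $x(ym)=(xy)m-(xm)y$; morphisms are the linear maps compatible with both actions. Write $\mathrm{Ext}^*_{\mathfrak g}$ and $\mathrm{Ext}^*_{\mathfrak{g}_{\mathrm{Lie}}}$ for Ext in these abelian categories. For a right $\mathfrak{g}_{\mathrm{Lie}}$-module $N$, let $N^{\mathrm{s}}$ and $N^{\mathrm{a}}$ be the $\mathfrak{g}$-modules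 with underlying space $N$, right action $nx=n\overline{x}$, and left action $xn=-n\overline{x}$ for $N^{\mathrm{s}}$, $xn=0$ for $N^{\mathrm{a}}$. Let $\mathfrak{g}^{\downarrow}$ be $\mathfrak{g}$ regarded as a right $\mathfrak{g}_{\mathrm{Lie}}$-module by right multiplication. Tensor products are over $\mathbb{k}$, and $N\otimes\mathfrak{g}^{\downarrow}$ and $\mathrm{Hom}_{\mathbb{k}}(\mathfrak{g}^{\downarrow},N)$ carry the diagonal actions $(n\otimes x)\overline{y}=n\overline{y}\otimes x+n\otimes xy$ and $(f\overline{y})(x)=f(x)\overline{y}-f(xy)$. Let $[\mathrm{lext}(N)]\in\mathrm{Ext}^1_{\mathfrak g}(N^{\mathrm{s}},(N\otimes\mathfrak{g}^{\downarrow})^{\mathrm{a}})$ be the class of the extension $$0\to (N\otimes\mathfrak{g}^{\downarrow})^{\mathrm{a}}\to \mathrm{lext}(N)\to N^{\mathrm{s}}\to 0,$$ where $\mathrm{lext}(N)=(N\otimes\mathfrak{g})\oplus N$ has the right action $[m\otimes x,n]y=[m\overline{y}\otimes x+m\otimes xy,\,n\overline{y}]$ and the left action $z[m\otimes x,n]=[n\otimes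 z,\,-n\overline{z}]$. Let $[\mathrm{rext}(N)]\in\mathrm{Ext}^1_{\mathfrak g}(\mathrm{Hom}_{\mathbb{k}}(\mathfrak{g}^{\downarrow},N)^{\mathrm{s}},N^{\mathrm{a}})$ be the class of the extension $$0\to N^{\mathrm{a}}\to \mathrm{rext}(N)\to \mathrm{Hom}_{\mathbb{k}}(\mathfrak{g}^{\downarrow},N)^{\mathrm{s}}\to 0,$$ where $\mathrm{rext}(N)=N\oplus\mathrm{Hom}_{\mathbb{k}}(\mathfrak{g},N)$ has the right action $(n,f)y=(n\overline{y},f\overline{y})$ and the left action $x(n,f)=(f(x),-f\overline{x})$. Then, for all right $\mathfrak{g}_{\mathrm{Lie}}$-modules $N_1,N_2$ and all $n\ge 0$ (with $\mathrm{Ext}^{-1}=0$): 1. There is a $\mathbb{k}$-linear isomorphism, natural in $N_1$ and $N_2$, $$\mathrm{Ext}^n_{\mathfrak g}(N_1^{\mathrm{s}},N_2^{\mathrm{s}})\cong \mathrm{Ext}^n_{\mathfrak{g}_{\mathrm{Lie}}}(N_1,N_2)\oplus \mathrm{Ext}^{n-1}_{\mathfrak g}((N_1\otimes\mathfrak{g}^{\downarrow})^{\mathrm{a}},N_2^{\mathrm{s}}),$$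 under which the inclusion of the first summand is the map induced by the exact functor $(-)^{\mathrm{s}}$ and the inclusion of the second summand is the Yoneda product with $[\mathrm{lext}(N_1)]$. 2. There is a $\mathbb{k}$-linear isomorphism, natural in $N_1$ and $N_2$, $$\mathrm{Ext}^n_{\mathfrak g}(N_1^{\mathrm{a}},N_2^{\mathrm{a}})\cong \mathrm{Ext}^n_{\mathfrak{g}_{\mathrm{Lie}}}(N_1,N_2)\oplus \mathrm{Ext}^{n-1}_{\mathfrak g}(N_1^{\mathrm{a}},\mathrm{Hom}_{\mathbb{k}}(\mathfrak{g}^{\downarrow},N_2)^{\mathrm{s}}),$$ under which the inclusion of the first summand is the map induced by the exact functor $(-)^{\mathrm{a}}$ and the inclusion of the second summand is the Yoneda product with $[\mathrm{rext}(N_2)]$. -/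

import Mathlib

universe u

open CategoryTheory CategoryTheory.Limits TensorProduct

namespace Leibniz

noncomputable section

/-! ### Leibniz algebras and the associated Lie algebra -/

/-- The (right) Leibniz relation. A Leibniz algebra over `k` is a `k`-vector space with a bilinear
product satisfying this relation; bilinearity is `NonUnitalNonAssocRing` together with
`IsScalarTower k g g` and `SMulCommClass k g g`. -/
class IsLeibniz (g : Type u) [NonUnitalNonAssocRing g] : Prop where
  leibniz : ∀ x y z : g, x * (y * z) = (x * y) * z - (x * z) * y

section LieQuotient

variable (k g : Type u) [Field k] [NonUnitalNonAssocRing g] [Module k g]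

/-- The subspace spanned by the squares `x * x`. -/
def squares : Submodule k g := Submodule.span k (Set.range fun x : g => x * x)

/-- The vector space `g_Lie = g / ⟨x²⟩`. -/
def GLie : Type u := g ⧸ squares k g

instance : AddCommGroup (GLie k g) := inferInstanceAs (AddCommGroup (g ⧸ squares k g))
instance : Module k (GLie k g) := inferInstanceAs (Module k (g ⧸ squares k g))

/-- The canonical surjection `g → g_Lie`. -/
def toLie : g →ₗ[k] GLie k g := (squares k g).mkQ

lemma toLie_surjective : Function.Surjective (toLie k g) := (squares k g).mkQ_surjective

lemma toLie_sq (x : g) : toLie k g (x * x) = 0 :=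
  (Submodule.Quotient.mk_eq_zero _).2 (Submodule.subset_span ⟨x, rfl⟩)

variable {k g} in
/-- Linear maps out of `g_Lie` are linear maps out of `g` killing the squares. -/
def liftLie {V : Type*} [AddCommGroup V] [Module k V] (f : g →ₗ[k] V)
    (hf : ∀ x, f (x * x) = 0) : GLie k g →ₗ[k] V :=
  (squares k g).liftQ f (by
    rw [squares, Submodule.span_le]
    rintro _ ⟨x, rfl⟩
    exact hf x)

variable {k g} in
@[simp] lemma liftLie_toLie {V : Type*} [AddCommGroup V] [Module k V] (f : g →ₗ[k] V)
    (hf : ∀ x, f (x * x) = 0) (x : g) : liftLie f hf (toLie k g x) = f x := rfl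

lemma toLie_antisymm (x y : g) : toLie k g (x * y) = - toLie k g (y * x) := by
  have h := toLie_sq k g (x + y)
  simp only [add_mul, mul_add, map_add, toLie_sq, zero_add, add_zero] at h
  exact eq_neg_of_add_eq_zero_right h

lemma toLie_sq_mul [IsLeibniz g] (x y : g) : toLie k g ((x * x) * y) = 0 := by
  rw [toLie_antisymm, IsLeibniz.leibniz]
  simp

variable [IsScalarTower k g g] [SMulCommClass k g g] [IsLeibniz g]

/-- The bracket of `g_Lie`, induced by the product of `g`. -/
def lieBracket : GLie k g →ₗ[k] GLie k g →ₗ[k] GLie k g :=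
  liftLie
    { toFun := fun x => liftLie (toLie k g ∘ₗ LinearMap.mul k g x) (fun y => by
        simp [IsLeibniz.leibniz])
      map_add' := fun x y => by
        ext z
        obtain ⟨z, rfl⟩ := toLie_surjective k g z
        simp
      map_smul' := fun c x => by
        ext z
        obtain ⟨z, rfl⟩ := toLie_surjective k g z
        simp }
    (fun x => by
      ext z
      obtain ⟨z, rfl⟩ := toLie_surjective k g z
      simp [toLie_sq_mul])

instance : Bracket (GLie k g) (GLie k g) := ⟨fun a b => lieBracket k g a b⟩

@[simp] lemma toLie_bracket (x y : g) : ⁅toLie k g x, toLie k g y⁆ = toLie k g (x * y) := rfl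

instance : LieRing (GLie k g) where
  add_lie a b c := by change lieBracket k g _ _ = lieBracket k g _ _ + lieBracket k g _ _; simp
  lie_add a b c := by change lieBracket k g _ _ = lieBracket k g _ _ + lieBracket k g _ _; simp
  lie_self a := by
    obtain ⟨x, rfl⟩ := toLie_surjective k g a
    simp [toLie_sq]
  leibniz_lie a b c := by
    obtain ⟨x, rfl⟩ := toLie_surjective k g a
    obtain ⟨y, rfl⟩ := toLie_surjective k g b
    obtain ⟨z, rfl⟩ := toLie_surjective k g c
    simp only [toLie_bracket]
    rw [toLie_antisymm k g y (x * z), IsLeibniz.leibniz x y z]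
    simp [sub_eq_add_neg]

instance : LieAlgebra k (GLie k g) where
  lie_smul c a b := by change lieBracket k g _ _ = c • lieBracket k g _ _; simp

end LieQuotient

/-! ### Right modules over a Lie algebra -/

/-- A right module over the Lie algebra `h`; `act x n` is `n · x`. -/
structure LieMod (k h : Type u) [Field k] [LieRing h] [LieAlgebra k h] : Type (u + 1) where
  carrier : Type u
  [addCommGroup : AddCommGroup carrier]
  [module : Module k carrier]
  act : h →ₗ[k] Module.End k carrier
  act_lie : ∀ (x y : h) (n : carrier), act ⁅x, y⁆ n = act y (act x n) - act x (act y n)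

namespace LieMod

attribute [instance] LieMod.addCommGroup LieMod.module

variable {k h : Type u} [Field k] [LieRing h] [LieAlgebra k h]

/-- A morphism of right modules: a linear map compatible with the actions. -/
@[ext] structure Hom (M N : LieMod k h) : Type u where
  lin : M.carrier →ₗ[k] N.carrier
  map_act : ∀ (x : h) (m : M.carrier), lin (M.act x m) = N.act x (lin m)

instance : Category (LieMod k h) where
  Hom := Hom
  id M := ⟨LinearMap.id, fun _ _ => rfl⟩
  comp f g := ⟨g.lin ∘ₗ f.lin, fun x m => by simp [f.map_act, g.map_act]⟩

@[ext] lemma hom_ext {M N : LieMod k h} {f g : M ⟶ N} (w : f.lin = g.lin) : f = g := Hom.ext w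

@[simp] lemma id_lin (M : LieMod k h) : Hom.lin (𝟙 M) = LinearMap.id := rfl
@[simp] lemma comp_lin {M N P : LieMod k h} (f : M ⟶ N) (g : N ⟶ P) :
    (f ≫ g).lin = g.lin ∘ₗ f.lin := rfl

variable (M N : LieMod k h)

instance : Zero (Hom M N) := ⟨⟨0, fun _ _ => by simp⟩⟩
instance : Add (Hom M N) :=
  ⟨fun f g => ⟨f.lin + g.lin, fun x m => by simp [f.map_act, g.map_act]⟩⟩
instance : Neg (Hom M N) := ⟨fun f => ⟨-f.lin, fun x m => by simp [f.map_act]⟩⟩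
instance : SMul k (Hom M N) := ⟨fun c f => ⟨c • f.lin, fun x m => by simp [f.map_act]⟩⟩

instance : AddCommGroup (Hom M N) where
  add_assoc f g h := Hom.ext (add_assoc f.lin g.lin h.lin)
  zero_add f := Hom.ext (zero_add f.lin)
  add_zero f := Hom.ext (add_zero f.lin)
  neg_add_cancel f := Hom.ext (neg_add_cancel f.lin)
  add_comm f g := Hom.ext (add_comm f.lin g.lin)
  nsmul := nsmulRec
  zsmul := zsmulRec

instance : Module k (Hom M N) where
  one_smul f := Hom.ext (one_smul k f.lin)
  mul_smul a b f := Hom.ext (mul_smul a b f.lin)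
  smul_zero a := Hom.ext (smul_zero a)
  smul_add a f g := Hom.ext (smul_add a f.lin g.lin)
  add_smul a b f := Hom.ext (add_smul a b f.lin)
  zero_smul f := Hom.ext (zero_smul k f.lin)

instance : Preadditive (LieMod k h) where
  homGroup M N := inferInstanceAs (AddCommGroup (Hom M N))
  add_comp _ _ _ f f' g := Hom.ext (LinearMap.comp_add f.lin f'.lin g.lin)
  comp_add _ _ _ f g g' := Hom.ext (LinearMap.add_comp f.lin g'.lin g.lin)

instance : Linear k (LieMod k h) where
  homModule M N := inferInstanceAs (Module k (Hom M N))
  smul_comp _ _ _ c f g := Hom.ext (LinearMap.comp_smul g.lin c f.lin)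
  comp_smul _ _ _ f c g := Hom.ext (LinearMap.smul_comp c g.lin f.lin)

variable {M N}
@[simp] lemma zero_lin : Hom.lin (0 : M ⟶ N) = 0 := rfl
@[simp] lemma add_lin (f g : M ⟶ N) : (f + g).lin = f.lin + g.lin := rfl
@[simp] lemma smul_lin (c : k) (f : M ⟶ N) : (c • f).lin = c • f.lin := rfl

variable (k h) in
/-- The relations of the opposite of the enveloping algebra of `h`. -/
inductive Rel : TensorAlgebra k h → TensorAlgebra k h → Prop
  | lie (x y : h) : Rel (TensorAlgebra.ι k ⁅x, y⁆)
      (TensorAlgebra.ι k y * TensorAlgebra.ι k x - TensorAlgebra.ι k x * TensorAlgebra.ι k y)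

variable (k h) in
/-- The opposite of the enveloping algebra of `h`: its left modules are the right `h`-modules. -/
abbrev Env : Type u := RingQuot (Rel k h)

/-- The image of `x : h` in the algebra. -/
def gen : h →ₗ[k] Env k h :=
  (RingQuot.mkAlgHom k (Rel k h)).toLinearMap ∘ₗ TensorAlgebra.ι k

lemma gen_lie (x y : h) : gen (k := k) ⁅x, y⁆ = gen y * gen x - gen x * gen y := by
  have := RingQuot.mkAlgHom_rel k (Rel.lie (k := k) x y)
  simpa [gen] using this

/-- The algebra acts on every right module. -/
def envAct (M : LieMod k h) : Env k h →ₐ[k] Module.End k M.carrier :=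
  RingQuot.liftAlgHom k ⟨TensorAlgebra.lift k M.act, by
    rintro _ _ ⟨x, y⟩
    ext n
    simp [M.act_lie]⟩

@[simp] lemma envAct_gen (M : LieMod k h) (x : h) : envAct M (gen x) = M.act x := by
  simp [envAct, gen]

lemma env_induction {p : Env k h → Prop} (hc : ∀ c, p (algebraMap k _ c)) (hg : ∀ x, p (gen x))
    (ha : ∀ a b, p a → p b → p (a + b)) (hm : ∀ a b, p a → p b → p (a * b)) (a : Env k h) :
    p a := by
  obtain ⟨a, rfl⟩ := RingQuot.mkAlgHom_surjective k (Rel k h) a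
  induction a using TensorAlgebra.induction with
  | algebraMap r => simpa using hc r
  | ι x => exact hg x
  | mul a b ha hb => simpa using hm _ _ ha hb
  | add a b ha' hb => simpa using ha _ _ ha' hb

/-- Right `h`-modules as modules over an associative algebra. -/
def toEnv : LieMod k h ⥤ ModuleCat.{u} (Env k h) where
  obj M :=
    letI : Module (Env k h) M.carrier := Module.compHom _ (envAct M).toRingHom
    ModuleCat.of _ M.carrier
  map {M N} f :=
    letI : Module (Env k h) M.carrier := Module.compHom _ (envAct M).toRingHom
    letI : Module (Env k h) N.carrier := Module.compHom _ (envAct N).toRingHom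
    ModuleCat.ofHom
      { toFun := f.lin
        map_add' := f.lin.map_add
        map_smul' := fun a => by
          change ∀ m, f.lin (envAct M a m) = envAct N a (f.lin m)
          induction a using env_induction with
          | hc c => simp
          | hg x => simp [f.map_act]
          | ha a b ha hb => simp [ha, hb]
          | hm a b ha hb => simp [ha, hb] }

lemma toEnv_smul (M : LieMod k h) (a : Env k h) (m : (toEnv.obj M : Type u)) :
    a • m = envAct M a m := rfl

instance : (toEnv (k := k) (h := h)).Faithful where
  map_injective {M N f g} w := by
    ext m
    exact congrArg (fun φ : toEnv.obj M ⟶ toEnv.obj N => φ.hom m) w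

instance : (toEnv (k := k) (h := h)).Full where
  map_surjective {M N} f := by
    let φ : M.carrier → N.carrier := fun m => f.hom m
    have key : ∀ a m, φ (envAct M a m) = envAct N a (φ m) := fun a m => f.hom.map_smul a m
    exact ⟨⟨
      { toFun := φ
        map_add' := fun m n => f.hom.map_add m n
        map_smul' := fun c m => by simpa using key (algebraMap k _ c) m },
      fun x m => by
        have := key (gen x) m
        rwa [envAct_gen, envAct_gen] at this⟩, rfl⟩

/-- A module over the algebra is a right `h`-module. -/
def ofEnv (V : ModuleCat.{u} (Env k h)) : LieMod k h :=
  letI : Module k V := Module.compHom V (algebraMap k (Env k h))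
  haveI : IsScalarTower k (Env k h) V := ⟨fun c a v => by
    change (c • a) • v = algebraMap k (Env k h) c • a • v
    rw [Algebra.smul_def, mul_smul]⟩
  { carrier := V
    act := (Algebra.lsmul k k V).toLinearMap ∘ₗ gen
    act_lie := fun x y n => by
      simp [gen_lie] }

lemma envAct_ofEnv (V : ModuleCat.{u} (Env k h)) (a : Env k h) :
    ∀ v : V, envAct (ofEnv V) a v = a • v := by
  induction a using env_induction with
  | hc c => intro v; rw [AlgHom.commutes]; rfl
  | hg x => intro v; rw [envAct_gen]; rfl
  | ha a b ha hb =>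
    intro v
    rw [map_add, add_smul, ← ha, ← hb]
    rfl
  | hm a b ha hb =>
    intro v
    rw [map_mul, mul_smul, ← hb]
    exact ha _

instance : (toEnv (k := k) (h := h)).EssSurj where
  mem_essImage V :=
    let e : (toEnv.obj (ofEnv V) : Type u) ≃ₗ[Env k h] V :=
      { toFun := fun v => v
        invFun := fun v => v
        map_add' := fun _ _ => rfl
        map_smul' := fun a v => envAct_ofEnv V a v
        left_inv := fun _ => rfl
        right_inv := fun _ => rfl }
    ⟨ofEnv V, ⟨e.toModuleIso⟩⟩

instance : (toEnv (k := k) (h := h)).IsEquivalence where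

instance : HasFiniteProducts (LieMod k h) :=
  ⟨fun _ => Adjunction.hasLimitsOfShape_of_equivalence toEnv⟩

instance : Abelian (LieMod k h) := abelianOfEquivalence toEnv

instance : HasExt.{u} (LieMod k h) :=
  haveI : EnoughProjectives (LieMod k h) :=
    toEnv.asEquivalence.enoughProjectives_iff.2 ModuleCat.enoughProjectives
  hasExt_of_enoughProjectives.{u} _

instance : (toEnv (k := k) (h := h)).Additive where
  map_add := rfl

/-- Short exactness is short exactness of the underlying maps. -/
lemma shortExact_iff (S : ShortComplex (LieMod k h)) : S.ShortExact ↔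
    Function.Injective S.f.lin ∧ Function.Exact S.f.lin S.g.lin ∧
      Function.Surjective S.g.lin := by
  rw [← ShortExact.shortExact_map_iff (F := toEnv)]
  exact ⟨fun H => ⟨H.moduleCat_injective_f,
    (ShortComplex.ShortExact.moduleCat_exact_iff_function_exact _).1 H.exact,
    H.moduleCat_surjective_g⟩,
    fun H => ModuleCat.shortComplex_shortExact _ H.2.1 H.1 H.2.2⟩

end LieMod

/-! ### Modules over a Leibniz algebra -/

/-- A module over the Leibniz algebra `g`; `left x m` is `x · m` and `right x m` is `m · x`. -/
structure LeibMod (k g : Type u) [Field k] [NonUnitalNonAssocRing g] [Module k g] :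
    Type (u + 1) where
  carrier : Type u
  [addCommGroup : AddCommGroup carrier]
  [module : Module k carrier]
  left : g →ₗ[k] Module.End k carrier
  right : g →ₗ[k] Module.End k carrier
  mll : ∀ (x y : g) (m : carrier),
    right (x * y) m = right y (right x m) - right x (right y m)
  lml : ∀ (x y : g) (m : carrier),
    left x (right y m) = right y (left x m) - left (x * y) m
  llm : ∀ (x y : g) (m : carrier),
    left x (left y m) = left (x * y) m - right y (left x m)

namespace LeibMod

attribute [instance] LeibMod.addCommGroup LeibMod.module

variable {k g : Type u} [Field k] [NonUnitalNonAssocRing g] [Module k g]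

/-- A morphism of `g`-modules: a linear map compatible with both actions. -/
@[ext] structure Hom (M N : LeibMod k g) : Type u where
  lin : M.carrier →ₗ[k] N.carrier
  map_left : ∀ (x : g) (m : M.carrier), lin (M.left x m) = N.left x (lin m)
  map_right : ∀ (x : g) (m : M.carrier), lin (M.right x m) = N.right x (lin m)

instance : Category (LeibMod k g) where
  Hom := Hom
  id M := ⟨LinearMap.id, fun _ _ => rfl, fun _ _ => rfl⟩
  comp f g := ⟨g.lin ∘ₗ f.lin, fun x m => by simp [f.map_left, g.map_left],
    fun x m => by simp [f.map_right, g.map_right]⟩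

@[ext] lemma hom_ext {M N : LeibMod k g} {f g : M ⟶ N} (w : f.lin = g.lin) : f = g := Hom.ext w

@[simp] lemma id_lin (M : LeibMod k g) : Hom.lin (𝟙 M) = LinearMap.id := rfl
@[simp] lemma comp_lin {M N P : LeibMod k g} (f : M ⟶ N) (g : N ⟶ P) :
    (f ≫ g).lin = g.lin ∘ₗ f.lin := rfl

variable (M N : LeibMod k g)

instance : Zero (Hom M N) := ⟨⟨0, fun _ _ => by simp, fun _ _ => by simp⟩⟩
instance : Add (Hom M N) :=
  ⟨fun f g => ⟨f.lin + g.lin, fun x m => by simp [f.map_left, g.map_left],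
    fun x m => by simp [f.map_right, g.map_right]⟩⟩
instance : Neg (Hom M N) := ⟨fun f => ⟨-f.lin, fun x m => by simp [f.map_left],
  fun x m => by simp [f.map_right]⟩⟩
instance : SMul k (Hom M N) := ⟨fun c f => ⟨c • f.lin,
  fun x m => by simp [f.map_left], fun x m => by simp [f.map_right]⟩⟩

instance : AddCommGroup (Hom M N) where
  add_assoc f g h := Hom.ext (add_assoc f.lin g.lin h.lin)
  zero_add f := Hom.ext (zero_add f.lin)
  add_zero f := Hom.ext (add_zero f.lin)
  neg_add_cancel f := Hom.ext (neg_add_cancel f.lin)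
  add_comm f g := Hom.ext (add_comm f.lin g.lin)
  nsmul := nsmulRec
  zsmul := zsmulRec

instance : Module k (Hom M N) where
  one_smul f := Hom.ext (one_smul k f.lin)
  mul_smul a b f := Hom.ext (mul_smul a b f.lin)
  smul_zero a := Hom.ext (smul_zero a)
  smul_add a f g := Hom.ext (smul_add a f.lin g.lin)
  add_smul a b f := Hom.ext (add_smul a b f.lin)
  zero_smul f := Hom.ext (zero_smul k f.lin)

instance : Preadditive (LeibMod k g) where
  homGroup M N := inferInstanceAs (AddCommGroup (Hom M N))
  add_comp _ _ _ f f' g := Hom.ext (LinearMap.comp_add f.lin f'.lin g.lin)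
  comp_add _ _ _ f g g' := Hom.ext (LinearMap.add_comp f.lin g'.lin g.lin)

instance : Linear k (LeibMod k g) where
  homModule M N := inferInstanceAs (Module k (Hom M N))
  smul_comp _ _ _ c f g := Hom.ext (LinearMap.comp_smul g.lin c f.lin)
  comp_smul _ _ _ f c g := Hom.ext (LinearMap.smul_comp c g.lin f.lin)

variable {M N}
@[simp] lemma zero_lin : Hom.lin (0 : M ⟶ N) = 0 := rfl
@[simp] lemma add_lin (f g : M ⟶ N) : (f + g).lin = f.lin + g.lin := rfl
@[simp] lemma smul_lin (c : k) (f : M ⟶ N) : (c • f).lin = c • f.lin := rfl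

variable (k g) in
/-- The relations of the opposite of the enveloping algebra of the Leibniz algebra `g`;
`(x, 0)` stands for the left action of `x` and `(0, x)` for the right action. -/
inductive Rel : TensorAlgebra k (g × g) → TensorAlgebra k (g × g) → Prop
  | mll (x y : g) : Rel (TensorAlgebra.ι k (0, x * y))
      (TensorAlgebra.ι k (0, y) * TensorAlgebra.ι k (0, x)
        - TensorAlgebra.ι k (0, x) * TensorAlgebra.ι k (0, y))
  | lml (x y : g) : Rel (TensorAlgebra.ι k (x, 0) * TensorAlgebra.ι k (0, y))
      (TensorAlgebra.ι k (0, y) * TensorAlgebra.ι k (x, 0) - TensorAlgebra.ι k (x * y, 0))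
  | llm (x y : g) : Rel (TensorAlgebra.ι k (x, 0) * TensorAlgebra.ι k (y, 0))
      (TensorAlgebra.ι k (x * y, 0) - TensorAlgebra.ι k (0, y) * TensorAlgebra.ι k (x, 0))

variable (k g) in
/-- The opposite of the enveloping algebra of `g`: its left modules are the `g`-modules. -/
abbrev Env : Type u := RingQuot (Rel k g)

/-- The image of a generator in the algebra. -/
def gen : g × g →ₗ[k] Env k g :=
  (RingQuot.mkAlgHom k (Rel k g)).toLinearMap ∘ₗ TensorAlgebra.ι k

lemma gen_mll (x y : g) : gen (k := k) ((0 : g), x * y) =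
    gen (0, y) * gen (0, x) - gen (0, x) * gen (0, y) := by
  have := RingQuot.mkAlgHom_rel k (Rel.mll (k := k) x y)
  simpa [gen] using this

lemma gen_lml (x y : g) : gen (k := k) (x, (0 : g)) * gen (0, y) =
    gen (0, y) * gen (x, 0) - gen (x * y, 0) := by
  have := RingQuot.mkAlgHom_rel k (Rel.lml (k := k) x y)
  simpa [gen] using this

lemma gen_llm (x y : g) : gen (k := k) (x, (0 : g)) * gen (y, 0) =
    gen (x * y, 0) - gen (0, y) * gen (x, 0) := by
  have := RingQuot.mkAlgHom_rel k (Rel.llm (k := k) x y)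
  simpa [gen] using this

/-- The algebra acts on every `g`-module. -/
def envAct (M : LeibMod k g) : Env k g →ₐ[k] Module.End k M.carrier :=
  RingQuot.liftAlgHom k ⟨TensorAlgebra.lift k (M.left.coprod M.right), by
    rintro _ _ (⟨x, y⟩ | ⟨x, y⟩ | ⟨x, y⟩) <;> ext n
    · simp [M.mll]
    · simp [M.lml]
    · simp [M.llm]⟩

@[simp] lemma envAct_gen (M : LeibMod k g) (x : g × g) :
    envAct M (gen x) = M.left x.1 + M.right x.2 := by
  simp [envAct, gen]

lemma env_induction {p : Env k g → Prop} (hc : ∀ c, p (algebraMap k _ c)) (hg : ∀ x, p (gen x))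
    (ha : ∀ a b, p a → p b → p (a + b)) (hm : ∀ a b, p a → p b → p (a * b)) (a : Env k g) :
    p a := by
  obtain ⟨a, rfl⟩ := RingQuot.mkAlgHom_surjective k (Rel k g) a
  induction a using TensorAlgebra.induction with
  | algebraMap r => simpa using hc r
  | ι x => exact hg x
  | mul a b ha hb => simpa using hm _ _ ha hb
  | add a b ha' hb => simpa using ha _ _ ha' hb

/-- `g`-modules as modules over an associative algebra. -/
def toEnv : LeibMod k g ⥤ ModuleCat.{u} (Env k g) where
  obj M :=
    letI : Module (Env k g) M.carrier := Module.compHom _ (envAct M).toRingHom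
    ModuleCat.of _ M.carrier
  map {M N} f :=
    letI : Module (Env k g) M.carrier := Module.compHom _ (envAct M).toRingHom
    letI : Module (Env k g) N.carrier := Module.compHom _ (envAct N).toRingHom
    ModuleCat.ofHom
      { toFun := f.lin
        map_add' := f.lin.map_add
        map_smul' := fun a => by
          change ∀ m, f.lin (envAct M a m) = envAct N a (f.lin m)
          induction a using env_induction with
          | hc c => simp
          | hg x => simp [f.map_left, f.map_right]
          | ha a b ha hb => simp [ha, hb]
          | hm a b ha hb => simp [ha, hb] }

lemma toEnv_smul (M : LeibMod k g) (a : Env k g) (m : (toEnv.obj M : Type u)) :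
    a • m = envAct M a m := rfl

instance : (toEnv (k := k) (g := g)).Faithful where
  map_injective {M N f g} w := by
    ext m
    exact congrArg (fun φ : toEnv.obj M ⟶ toEnv.obj N => φ.hom m) w

instance : (toEnv (k := k) (g := g)).Full where
  map_surjective {M N} f := by
    let φ : M.carrier → N.carrier := fun m => f.hom m
    have key : ∀ a m, φ (envAct M a m) = envAct N a (φ m) := fun a m => f.hom.map_smul a m
    exact ⟨⟨
      { toFun := φ
        map_add' := fun m n => f.hom.map_add m n
        map_smul' := fun c m => by simpa using key (algebraMap k _ c) m },
      fun x m => by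
        have := key (gen (x, 0)) m
        rw [envAct_gen, envAct_gen] at this
        simp only [map_zero, add_zero] at this
        exact this, fun x m => by
        have := key (gen (0, x)) m
        rw [envAct_gen, envAct_gen] at this
        simp only [map_zero, zero_add] at this
        exact this⟩, rfl⟩

/-- A module over the algebra is a `g`-module. -/
def ofEnv (V : ModuleCat.{u} (Env k g)) : LeibMod k g :=
  letI : Module k V := Module.compHom V (algebraMap k (Env k g))
  haveI : IsScalarTower k (Env k g) V := ⟨fun c a v => by
    change (c • a) • v = algebraMap k (Env k g) c • a • v
    rw [Algebra.smul_def, mul_smul]⟩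
  { carrier := V
    left := (Algebra.lsmul k k V).toLinearMap ∘ₗ gen ∘ₗ LinearMap.inl k g g
    right := (Algebra.lsmul k k V).toLinearMap ∘ₗ gen ∘ₗ LinearMap.inr k g g
    mll := fun x y n => by
      simp [gen_mll]
    lml := fun x y n => by
      have := congrArg (· • n) (gen_lml (k := k) x y)
      simpa [sub_smul, mul_smul] using this
    llm := fun x y n => by
      have := congrArg (· • n) (gen_llm (k := k) x y)
      simpa [sub_smul, mul_smul] using this }

lemma envAct_ofEnv (V : ModuleCat.{u} (Env k g)) (a : Env k g) :
    ∀ v : V, envAct (ofEnv V) a v = a • v := by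
  induction a using env_induction with
  | hc c => intro v; rw [AlgHom.commutes]; rfl
  | hg x =>
    intro v
    rw [envAct_gen]
    change gen (k := k) (x.1, (0 : g)) • v + gen (k := k) ((0 : g), x.2) • v = _
    rw [← add_smul, ← map_add]
    simp
  | ha a b ha hb =>
    intro v
    rw [map_add, add_smul, ← ha, ← hb]
    rfl
  | hm a b ha hb =>
    intro v
    rw [map_mul, mul_smul, ← hb]
    exact ha _

instance : (toEnv (k := k) (g := g)).EssSurj where
  mem_essImage V :=
    let e : (toEnv.obj (ofEnv V) : Type u) ≃ₗ[Env k g] V :=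
      { toFun := fun v => v
        invFun := fun v => v
        map_add' := fun _ _ => rfl
        map_smul' := fun a v => envAct_ofEnv V a v
        left_inv := fun _ => rfl
        right_inv := fun _ => rfl }
    ⟨ofEnv V, ⟨e.toModuleIso⟩⟩

instance : (toEnv (k := k) (g := g)).IsEquivalence where

instance : HasFiniteProducts (LeibMod k g) :=
  ⟨fun _ => Adjunction.hasLimitsOfShape_of_equivalence toEnv⟩

instance : Abelian (LeibMod k g) := abelianOfEquivalence toEnv

instance : HasExt.{u} (LeibMod k g) :=
  haveI : EnoughProjectives (LeibMod k g) :=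
    toEnv.asEquivalence.enoughProjectives_iff.2 ModuleCat.enoughProjectives
  hasExt_of_enoughProjectives.{u} _

instance : (toEnv (k := k) (g := g)).Additive where
  map_add := rfl

/-- Short exactness is short exactness of the underlying maps. -/
lemma shortExact_iff (S : ShortComplex (LeibMod k g)) : S.ShortExact ↔
    Function.Injective S.f.lin ∧ Function.Exact S.f.lin S.g.lin ∧
      Function.Surjective S.g.lin := by
  rw [← ShortExact.shortExact_map_iff (F := toEnv)]
  exact ⟨fun H => ⟨H.moduleCat_injective_f,
    (ShortComplex.ShortExact.moduleCat_exact_iff_function_exact _).1 H.exact,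
    H.moduleCat_surjective_g⟩,
    fun H => ModuleCat.shortComplex_shortExact _ H.2.1 H.1 H.2.2⟩

end LeibMod

/-! ### Functors between the two module categories -/

section Functors

variable (k g : Type u) [Field k] [NonUnitalNonAssocRing g] [Module k g]
  [IsScalarTower k g g] [SMulCommClass k g g] [IsLeibniz g]

/-- The functor `N ↦ N^a`: right action through `g → g_Lie`, zero left action. -/
def asym : LieMod k (GLie k g) ⥤ LeibMod k g where
  obj N :=
    { carrier := N.carrier
      left := 0
      right := N.act ∘ₗ toLie k g
      mll := fun x y m => by simp [← N.act_lie]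
      lml := fun x y m => by simp
      llm := fun x y m => by simp }
  map f := ⟨f.lin, fun x m => by simp, fun x m => f.map_act _ m⟩

/-- The functor `N ↦ N^s`: right action through `g → g_Lie`, left action `x · n = -(n · x)`. -/
def sym : LieMod k (GLie k g) ⥤ LeibMod k g where
  obj N :=
    { carrier := N.carrier
      left := -(N.act ∘ₗ toLie k g)
      right := N.act ∘ₗ toLie k g
      mll := fun x y m => by simp [← N.act_lie]
      lml := fun x y m => by
        simp [← toLie_bracket, N.act_lie]
        abel
      llm := fun x y m => by simp [← toLie_bracket, N.act_lie] }
  map f := ⟨f.lin, fun x m => by simpa using f.map_act _ m, fun x m => f.map_act _ m⟩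

variable {k g} in
/-- `M^↓`: restriction to the right action, which factors through `g_Lie`. -/
def downObj (M : LeibMod k g) : LieMod k (GLie k g) where
  carrier := M.carrier
  act := liftLie M.right (fun x => by ext m; simp [M.mll])
  act_lie x y m := by
    obtain ⟨x, rfl⟩ := toLie_surjective k g x
    obtain ⟨y, rfl⟩ := toLie_surjective k g y
    simp [M.mll]

/-- The functor `M ↦ M^↓`. -/
def down : LeibMod k g ⥤ LieMod k (GLie k g) where
  obj M := downObj M
  map {M N} f := ⟨f.lin, fun x => by
    obtain ⟨x, rfl⟩ := toLie_surjective k g x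
    exact f.map_right x⟩

/-- The adjoint module: `g` acting on itself by its product. -/
def adjoint : LeibMod k g where
  carrier := g
  left := LinearMap.mul k g
  right := (LinearMap.mul k g).flip
  mll x y m := by simp [IsLeibniz.leibniz]
  lml x y m := by simp [IsLeibniz.leibniz]
  llm x y m := by simp [IsLeibniz.leibniz]

/-- `g^↓`: the space `g` as a right `g_Lie`-module. -/
def gDown : LieMod k (GLie k g) := (down k g).obj (adjoint k g)

instance : (asym k g).Additive where
  map_add := rfl

instance : (sym k g).Additive where
  map_add := rfl

lemma asym_exact : PreservesFiniteLimits (asym k g) ∧ PreservesFiniteColimits (asym k g) :=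
  ((asym k g).exact_tfae.out 0 3).1 fun S hS =>
    (LeibMod.shortExact_iff _).2 ((LieMod.shortExact_iff S).1 hS)

lemma sym_exact : PreservesFiniteLimits (sym k g) ∧ PreservesFiniteColimits (sym k g) :=
  ((sym k g).exact_tfae.out 0 3).1 fun S hS =>
    (LeibMod.shortExact_iff _).2 ((LieMod.shortExact_iff S).1 hS)

instance : PreservesFiniteLimits (asym k g) := (asym_exact k g).1
instance : PreservesFiniteColimits (asym k g) := (asym_exact k g).2
instance : PreservesFiniteLimits (sym k g) := (sym_exact k g).1
instance : PreservesFiniteColimits (sym k g) := (sym_exact k g).2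

end Functors

/-! ### Tensor product and internal hom of right Lie modules -/

section Closed

variable {k h : Type u} [Field k] [LieRing h] [LieAlgebra k h]

/-- The diagonal action `(n ⊗ p) · x = (n · x) ⊗ p + n ⊗ (p · x)`. -/
def tensorAct (N P : LieMod k h) : h →ₗ[k] Module.End k (N.carrier ⊗[k] P.carrier) where
  toFun x := (N.act x).rTensor P.carrier + (P.act x).lTensor N.carrier
  map_add' x y := by
    simp only [map_add, LinearMap.rTensor_add, LinearMap.lTensor_add]
    abel
  map_smul' c x := by
    simp [LinearMap.rTensor_smul, LinearMap.lTensor_smul]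

@[simp] lemma tensorAct_tmul (N P : LieMod k h) (x : h) (n : N.carrier) (p : P.carrier) :
    tensorAct N P x (n ⊗ₜ p) = N.act x n ⊗ₜ p + n ⊗ₜ P.act x p := rfl

/-- The right module `N ⊗ P`. -/
def tensorObj (N P : LieMod k h) : LieMod k h where
  carrier := N.carrier ⊗[k] P.carrier
  act := tensorAct N P
  act_lie x y t := by
    induction t with
    | zero => simp
    | add s t hs ht => rw [map_add, hs, ht]; simp only [map_add]; abel
    | tmul n p =>
      simp [N.act_lie, P.act_lie, TensorProduct.sub_tmul, TensorProduct.tmul_sub]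
      abel

lemma rTensor_tensorAct (P : LieMod k h) {N N' : LieMod k h} (f : N ⟶ N') (x : h)
    (t : N.carrier ⊗[k] P.carrier) : f.lin.rTensor P.carrier (tensorAct N P x t) =
      tensorAct N' P x (f.lin.rTensor P.carrier t) := by
  induction t with
  | zero => simp
  | add s t hs ht => simp only [map_add, hs, ht]
  | tmul n p => simp [f.map_act]

/-- The functor `N ↦ N ⊗ P`. -/
def tensorRight (P : LieMod k h) : LieMod k h ⥤ LieMod k h where
  obj N := tensorObj N P
  map f := ⟨f.lin.rTensor P.carrier, rTensor_tensorAct P f⟩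
  map_id _ := LieMod.hom_ext (LinearMap.rTensor_id _ _)
  map_comp _ _ := LieMod.hom_ext (LinearMap.rTensor_comp _ _ _)

/-- The diagonal action `(f · x)(p) = f(p) · x - f(p · x)`. -/
def homAct (P N : LieMod k h) : h →ₗ[k] Module.End k (P.carrier →ₗ[k] N.carrier) where
  toFun x :=
    { toFun := fun f => N.act x ∘ₗ f - f ∘ₗ P.act x
      map_add' := fun f f' => by ext p; simp; abel
      map_smul' := fun c f => by ext p; simp [smul_sub] }
  map_add' x y := by ext f p; simp; abel
  map_smul' c x := by ext f p; simp [smul_sub]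

@[simp] lemma homAct_apply (P N : LieMod k h) (x : h) (f : P.carrier →ₗ[k] N.carrier)
    (p : P.carrier) : homAct P N x f p = N.act x (f p) - f (P.act x p) := rfl

/-- The right module `Hom_k(P, N)`. -/
def homObj (P N : LieMod k h) : LieMod k h where
  carrier := P.carrier →ₗ[k] N.carrier
  act := homAct P N
  act_lie x y f := by
    ext p
    simp [N.act_lie, P.act_lie]
    abel

lemma comp_homAct (P : LieMod k h) {N N' : LieMod k h} (f : N ⟶ N') (x : h)
    (φ : P.carrier →ₗ[k] N.carrier) :
    f.lin ∘ₗ homAct P N x φ = homAct P N' x (f.lin ∘ₗ φ) := by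
  ext p
  simp [f.map_act]

/-- The functor `N ↦ Hom_k(P, N)`. -/
def homRight (P : LieMod k h) : LieMod k h ⥤ LieMod k h where
  obj N := homObj P N
  map f := ⟨LinearMap.llcomp k _ _ _ f.lin, comp_homAct P f⟩

end Closed

/-! ### The two universal extensions -/

section Extensions

variable {k g : Type u} [Field k] [NonUnitalNonAssocRing g] [Module k g]
  [IsScalarTower k g g] [SMulCommClass k g g] [IsLeibniz g]

/-- The right action on `(N ⊗ g) ⊕ N`:
`[m ⊗ x, n] · y = [(m · y) ⊗ x + m ⊗ (x y), n · y]`. -/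
def lextRight (N : LieMod k (GLie k g)) :
    g →ₗ[k] Module.End k ((N.carrier ⊗[k] g) × N.carrier) where
  toFun y := LinearMap.prodMap
    ((N.act (toLie k g y)).rTensor g + (LinearMap.mulRight k y).lTensor N.carrier)
    (N.act (toLie k g y))
  map_add' x y := by ext <;> simp [tmul_add, mul_add]; abel
  map_smul' c x := by ext <;> simp [mul_smul_comm]

/-- The left action on `(N ⊗ g) ⊕ N`: `z · [m ⊗ x, n] = [n ⊗ z, -(n · z)]`. -/
def lextLeft (N : LieMod k (GLie k g)) :
    g →ₗ[k] Module.End k ((N.carrier ⊗[k] g) × N.carrier) where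
  toFun z := LinearMap.prod
    ((TensorProduct.mk k N.carrier g).flip z ∘ₗ LinearMap.snd k _ _)
    (-(N.act (toLie k g z) ∘ₗ LinearMap.snd k _ _))
  map_add' x y := by ext <;> simp; abel
  map_smul' c x := by ext <;> simp

@[simp] lemma lextRight_apply (N : LieMod k (GLie k g)) (y : g)
    (p : (N.carrier ⊗[k] g) × N.carrier) : lextRight N y p =
      ((N.act (toLie k g y)).rTensor g p.1 + (LinearMap.mulRight k y).lTensor N.carrier p.1,
        N.act (toLie k g y) p.2) := rfl

@[simp] lemma lextLeft_apply (N : LieMod k (GLie k g)) (z : g)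
    (p : (N.carrier ⊗[k] g) × N.carrier) :
    lextLeft N z p = (p.2 ⊗ₜ z, -N.act (toLie k g z) p.2) := rfl

lemma act_mul (N : LieMod k (GLie k g)) (x y : g) (n : N.carrier) :
    N.act (toLie k g (x * y)) n = N.act (toLie k g y) (N.act (toLie k g x) n)
      - N.act (toLie k g x) (N.act (toLie k g y) n) := by
  rw [← toLie_bracket, N.act_lie]

/-- The `g`-module `lext N`. -/
def lext (N : LieMod k (GLie k g)) : LeibMod k g where
  carrier := (N.carrier ⊗[k] g) × N.carrier
  left := lextLeft N
  right := lextRight N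
  mll x y p := by
    obtain ⟨t, n⟩ := p
    refine Prod.ext ?_ (act_mul N x y n)
    simp only [lextRight_apply, Prod.fst_sub]
    induction t with
    | zero => simp
    | add s t hs ht => simp only [map_add] at hs ht ⊢; rw [add_add_add_comm, hs, ht]; abel
    | tmul m z =>
      simp [act_mul, IsLeibniz.leibniz, sub_tmul, tmul_sub]
      abel
  lml x y p := by
    obtain ⟨t, n⟩ := p
    ext
    · simp
    · simp [act_mul]
      abel
  llm x y p := by
    obtain ⟨t, n⟩ := p
    ext
    · simp [neg_tmul]
    · simp [act_mul]

lemma inl_lextLeft (N : LieMod k (GLie k g)) (x : g) (t : N.carrier ⊗[k] g) :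
    ((0 : N.carrier ⊗[k] g), (0 : N.carrier)) = lextLeft N x (t, 0) := by simp

lemma inl_lextRight (N : LieMod k (GLie k g)) (y : g) (t : N.carrier ⊗[k] g) :
    ((N.act (toLie k g y)).rTensor g t + (LinearMap.mulRight k y).lTensor N.carrier t,
      (0 : N.carrier)) = lextRight N y (t, 0) := by simp

/-- The short complex `(N ⊗ g^↓)^a → lext N → N^s`. -/
def lextSeq (N : LieMod k (GLie k g)) : ShortComplex (LeibMod k g) where
  X₁ := (asym k g).obj ((tensorRight (gDown k g)).obj N)
  X₂ := lext N
  X₃ := (sym k g).obj N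
  f := ⟨LinearMap.inl k (N.carrier ⊗[k] g) N.carrier, inl_lextLeft N, inl_lextRight N⟩
  g := ⟨LinearMap.snd k (N.carrier ⊗[k] g) N.carrier, fun _ _ => rfl, fun _ _ => rfl⟩
  zero := rfl

/-- The right action on `N ⊕ Hom_k(g, N)`: `(n, f) · y = (n · y, f · y)`. -/
def rextRight (N : LieMod k (GLie k g)) :
    g →ₗ[k] Module.End k (N.carrier × (g →ₗ[k] N.carrier)) where
  toFun y :=
    { toFun := fun p => (N.act (toLie k g y) p.1,
        N.act (toLie k g y) ∘ₗ p.2 - p.2 ∘ₗ LinearMap.mulRight k y)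
      map_add' := fun p q => by ext <;> simp; abel
      map_smul' := fun c p => by ext <;> simp [smul_sub] }
  map_add' x y := by ext <;> simp [mul_add]; abel
  map_smul' c x := by ext <;> simp [smul_sub, mul_smul_comm]

/-- The left action on `N ⊕ Hom_k(g, N)`: `x · (n, f) = (f(x), -(f · x))`. -/
def rextLeft (N : LieMod k (GLie k g)) :
    g →ₗ[k] Module.End k (N.carrier × (g →ₗ[k] N.carrier)) where
  toFun x :=
    { toFun := fun p => (p.2 x, -(N.act (toLie k g x) ∘ₗ p.2 - p.2 ∘ₗ LinearMap.mulRight k x))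
      map_add' := fun p q => by ext <;> simp; abel
      map_smul' := fun c p => by ext <;> simp [smul_sub] }
  map_add' x y := by ext <;> simp [mul_add]; abel
  map_smul' c x := by ext <;> simp [smul_sub, mul_smul_comm]

@[simp] lemma rextRight_apply (N : LieMod k (GLie k g)) (y : g)
    (p : N.carrier × (g →ₗ[k] N.carrier)) : rextRight N y p =
      (N.act (toLie k g y) p.1,
        N.act (toLie k g y) ∘ₗ p.2 - p.2 ∘ₗ LinearMap.mulRight k y) := rfl

@[simp] lemma rextLeft_apply (N : LieMod k (GLie k g)) (x : g)
    (p : N.carrier × (g →ₗ[k] N.carrier)) : rextLeft N x p =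
      (p.2 x, -(N.act (toLie k g x) ∘ₗ p.2 - p.2 ∘ₗ LinearMap.mulRight k x)) := rfl

/-- The `g`-module `rext N`. -/
def rext (N : LieMod k (GLie k g)) : LeibMod k g where
  carrier := N.carrier × (g →ₗ[k] N.carrier)
  left := rextLeft N
  right := rextRight N
  mll x y p := by
    ext
    · simp [act_mul]
    · simp [act_mul, IsLeibniz.leibniz]
      abel
  lml x y p := by
    ext
    · simp
    · simp [act_mul, IsLeibniz.leibniz]
      abel
  llm x y p := by
    ext
    · simp
    · simp [act_mul, IsLeibniz.leibniz]
      abel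

lemma inl_rextLeft (N : LieMod k (GLie k g)) (x : g) (n : N.carrier) :
    ((0 : N.carrier), (0 : g →ₗ[k] N.carrier)) = rextLeft N x (n, 0) := by simp

lemma inl_rextRight (N : LieMod k (GLie k g)) (y : g) (n : N.carrier) :
    (N.act (toLie k g y) n, (0 : g →ₗ[k] N.carrier)) = rextRight N y (n, 0) := by simp

/-- The short complex `N^a → rext N → Hom_k(g^↓, N)^s`. -/
def rextSeq (N : LieMod k (GLie k g)) : ShortComplex (LeibMod k g) where
  X₁ := (asym k g).obj N
  X₂ := rext N
  X₃ := (sym k g).obj ((homRight (gDown k g)).obj N)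
  f := ⟨LinearMap.inl k N.carrier (g →ₗ[k] N.carrier), inl_rextLeft N, inl_rextRight N⟩
  g := ⟨LinearMap.snd k N.carrier (g →ₗ[k] N.carrier), fun _ _ => rfl, fun _ _ => rfl⟩
  zero := rfl

lemma inl_snd_shortExact (V W : Type u) [AddCommGroup V] [Module k V] [AddCommGroup W]
    [Module k W] : Function.Injective (LinearMap.inl k V W) ∧
      Function.Exact (LinearMap.inl k V W) (LinearMap.snd k V W) ∧
      Function.Surjective (LinearMap.snd k V W) :=
  ⟨LinearMap.inl_injective, Function.Exact.inl_snd, LinearMap.snd_surjective⟩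

lemma lextSeq_shortExact (N : LieMod k (GLie k g)) : (lextSeq N).ShortExact :=
  (LeibMod.shortExact_iff _).2 (inl_snd_shortExact (N.carrier ⊗[k] g) N.carrier)

lemma rextSeq_shortExact (N : LieMod k (GLie k g)) : (rextSeq N).ShortExact :=
  (LeibMod.shortExact_iff _).2 (inl_snd_shortExact N.carrier (g →ₗ[k] N.carrier))

/-- The class of `0 → (N ⊗ g^↓)^a → lext N → N^s → 0`. -/
def lextClass (N : LieMod k (GLie k g)) : Abelian.Ext ((sym k g).obj N)
    ((asym k g).obj ((tensorRight (gDown k g)).obj N)) 1 :=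
  (lextSeq_shortExact N).extClass

/-- The class of `0 → N^a → rext N → Hom_k(g^↓, N)^s → 0`. -/
def rextClass (N : LieMod k (GLie k g)) : Abelian.Ext
    ((sym k g).obj ((homRight (gDown k g)).obj N)) ((asym k g).obj N) 1 :=
  (rextSeq_shortExact N).extClass

end Extensions

/-! ### Ext groups: functoriality and the shifted groups -/

section Ext

variable {C : Type (u + 1)} [Category.{u} C] [Abelian C] [HasExt.{u} C]

/-- The map `Ext^n(X, Y) → Ext^n(X', Y')` induced by `f : X' ⟶ X` and `h : Y ⟶ Y'`. -/
def extMap {X X' Y Y' : C} (f : X' ⟶ X) (h : Y ⟶ Y') {n : ℕ} (ξ : Abelian.Ext X Y n) :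
    Abelian.Ext X' Y' n :=
  (Abelian.Ext.mk₀ f).comp (ξ.comp (Abelian.Ext.mk₀ h) (add_zero n)) (zero_add n)

/-- The group `Ext^{n-1}(X, Y)`, which is `0` for `n = 0`. -/
def ExtPred (X Y : C) : ℕ → Type u
  | 0 => PUnit
  | n + 1 => Abelian.Ext X Y n

instance (X Y : C) : ∀ n, AddCommGroup (ExtPred X Y n)
  | 0 => (PUnit.addCommGroup : AddCommGroup PUnit.{u + 1})
  | n + 1 => (inferInstance : AddCommGroup (Abelian.Ext X Y n))

instance (k : Type u) [Field k] [Linear k C] (X Y : C) : ∀ n, Module k (ExtPred X Y n)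
  | 0 => (inferInstance : Module k PUnit.{u + 1})
  | n + 1 => (inferInstance : Module k (Abelian.Ext X Y n))

/-- The map `Ext^{n-1}(X, Y) → Ext^{n-1}(X', Y')` induced by `f : X' ⟶ X` and `h : Y ⟶ Y'`. -/
def extPredMap {X X' Y Y' : C} (f : X' ⟶ X) (h : Y ⟶ Y') :
    ∀ {n : ℕ}, ExtPred X Y n → ExtPred X' Y' n
  | 0, _ => PUnit.unit
  | _ + 1, β => extMap f h β

/-- Yoneda product `Ext^{n-1}(Y, Z) → Ext^n(X, Z)` with a class in `Ext^1(X, Y)`. -/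
def yonedaLeft {X Y : C} (ε : Abelian.Ext X Y 1) {Z : C} :
    ∀ {n : ℕ}, ExtPred Y Z n → Abelian.Ext X Z n
  | 0, _ => 0
  | n + 1, β => ε.comp β (add_comm 1 n)

/-- Yoneda product `Ext^{n-1}(X, Y) → Ext^n(X, Z)` with a class in `Ext^1(Y, Z)`. -/
def yonedaRight {Y Z : C} (ε : Abelian.Ext Y Z 1) {X : C} :
    ∀ {n : ℕ}, ExtPred X Y n → Abelian.Ext X Z n
  | 0, _ => 0
  | _ + 1, β => Abelian.Ext.comp β ε rfl

end Ext

end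

end Leibniz

/-! Restriction to the right action is an exact functor `down` from `g`-modules to right
`g_Lie`-modules. It has an exact left adjoint `lext` and an exact right adjoint `rext`. An
adjunction of exact functors passes to Ext, so that `Ext_g(lext N, Z)` is `Ext_Lie(N, Z^↓)` and
`Ext_g(Z, rext N)` is `Ext_Lie(Z^↓, N)`.

For part 1, consider the long exact sequence of `lext N₁` with coefficients in `N₂^s`. Under the
adjunction, its map from `Ext(N₁^s, N₂^s)` to `Ext(lext N₁, N₂^s)` becomes the map induced by
`down`. Since `N^s` restricts to `N`, the functor `sym` induces a section of that map. The long
exact sequence therefore breaks into split short exact sequences: the kernel is the injective image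
of the Yoneda product with the class of `lext N₁`, and the image of `sym` is a complement. Part 2 is
dual, with `rext N₂`, `asym` and the covariant sequence.

The splitting is proved for exact functors `S` and `R` with `S ⋙ R ≅ 𝟭`
(`bijective_mapExt_coprod_yonedaLeft`, `bijective_mapExt_coprod_yonedaRight`). Of the Ext adjunction
only injectivity is used; it rests on `mapExactFunctor_naturality` and a triangle identity. The
specific input is `lextAdjunction` and `rextAdjunction`. -/

namespace Leibniz

noncomputable section

/-! ### Exact functors and natural transformations on Ext groups -/

section ExtNaturality

open Abelian

variable {A B C : Type (u + 1)} [Category.{u} A] [Abelian A] [HasExt.{u} A]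
  [Category.{u} B] [Abelian B] [HasExt.{u} B] [Category.{u} C] [Abelian C] [HasExt.{u} C]

/-- With enough projectives, every Ext class is an iterated product of classes of short exact
sequences and a morphism. -/
lemma ext_induction [EnoughProjectives A]
    {motive : ∀ {X Y : A} {n : ℕ}, Ext X Y n → Prop}
    (mk₀ : ∀ {X Y : A} (f : X ⟶ Y), motive (Ext.mk₀ f))
    (extClass_comp : ∀ {S : ShortComplex A} (hS : S.ShortExact) {Y : A} {n : ℕ}
      (β : Ext S.X₁ Y n), motive β → motive (hS.extClass.comp β (add_comm 1 n)))
    {X Y : A} {n : ℕ} (α : Ext X Y n) : motive α := by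
  induction n generalizing X with
  | zero =>
    obtain ⟨f, rfl⟩ := (Ext.mk₀_bijective X Y).2 α
    exact mk₀ f
  | succ n ih =>
    let P : ProjectivePresentation X := Classical.arbitrary _
    let S := ShortComplex.mk _ _ (kernel.condition P.f)
    have hS : S.ShortExact := { exact := ShortComplex.exact_kernel P.f }
    have : Projective S.X₂ := P.projective
    -- Dimension shift: the pullback of `α` to the projective middle term has positive degree, so it
    -- vanishes and `α` factors through the class of the extension. The factor `β` starts at the
    -- kernel, hence the induction over all `X`.
    obtain ⟨β, rfl⟩ := Ext.contravariant_sequence_exact₃ hS Y α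
      (Ext.eq_zero_of_projective _) (add_comm 1 n)
    exact extClass_comp hS β (ih β)

variable (F F' : A ⥤ B) [F.Additive] [PreservesFiniteLimits F] [PreservesFiniteColimits F]
  [F'.Additive] [PreservesFiniteLimits F'] [PreservesFiniteColimits F']
  (G : B ⥤ C) [G.Additive] [PreservesFiniteLimits G] [PreservesFiniteColimits G]

/-- A natural transformation of exact functors is natural with respect to Ext classes. -/
lemma mapExactFunctor_naturality [EnoughProjectives A] (τ : F ⟶ F') {X Y : A} {n : ℕ}
    (α : Ext X Y n) :
    (α.mapExactFunctor F).comp (Ext.mk₀ (τ.app Y)) (add_zero n) =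
      (Ext.mk₀ (τ.app X)).comp (α.mapExactFunctor F') (zero_add n) := by
  induction α using ext_induction with
  | mk₀ f => simp [Ext.mapExactFunctor_mk₀]
  | @extClass_comp S hS Y n β ih =>
    -- In degree one, `τ` is a morphism of extensions from the image of `S` under `F` to its image
    -- under `F'`, and classes of extensions are natural. It then remains to move `τ` past `β` by
    -- induction and past the class by `h`.
    have h : (hS.extClass.mapExactFunctor F).comp (Ext.mk₀ (τ.app S.X₁)) (add_zero 1) =
        (Ext.mk₀ (τ.app S.X₃)).comp (hS.extClass.mapExactFunctor F') (zero_add 1) := by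
      rw [Ext.mapExactFunctor_extClass, Ext.mapExactFunctor_extClass]
      exact ShortComplex.ShortExact.extClass_naturality (hS.map_of_exact F)
        (hS.map_of_exact F') (S.mapNatTrans τ)
    rw [Ext.mapExactFunctor_comp, Ext.mapExactFunctor_comp, Ext.comp_assoc_of_third_deg_zero, ih,
      ← Ext.comp_assoc_of_second_deg_zero, h]
    exact Ext.comp_assoc _ _ _ _ _ (by lia)

lemma mapExactFunctor_id [EnoughProjectives A] {X Y : A} {n : ℕ} (α : Ext X Y n) :
    α.mapExactFunctor (𝟭 A) = α := by
  induction α using ext_induction with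
  | mk₀ f => exact Ext.mapExactFunctor_mk₀ _ f
  | extClass_comp hS β ih =>
    rw [Ext.mapExactFunctor_comp, ih, Ext.mapExactFunctor_extClass]
    rfl

lemma mapExactFunctor_functor_comp [EnoughProjectives A] {X Y : A} {n : ℕ} (α : Ext X Y n) :
    α.mapExactFunctor (F ⋙ G) = (α.mapExactFunctor F).mapExactFunctor G := by
  induction α using ext_induction with
  | mk₀ f => simp [Ext.mapExactFunctor_mk₀]
  | extClass_comp hS β ih =>
    have h : hS.extClass.mapExactFunctor (F ⋙ G) =
        (hS.extClass.mapExactFunctor F).mapExactFunctor G := by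
      rw [Ext.mapExactFunctor_extClass, Ext.mapExactFunctor_extClass]
      exact (Ext.mapExactFunctor_extClass G (hS.map_of_exact F)).symm
    rw [Ext.mapExactFunctor_comp, ih, h, Ext.mapExactFunctor_comp, Ext.mapExactFunctor_comp]

lemma mapExactFunctor_extMap {X X' Y Y' : A} (f : X' ⟶ X) (h : Y ⟶ Y') {n : ℕ}
    (α : Ext X Y n) :
    (extMap f h α).mapExactFunctor F = extMap (F.map f) (F.map h) (α.mapExactFunctor F) := by
  simp [extMap, Ext.mapExactFunctor_comp, Ext.mapExactFunctor_mk₀]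

end ExtNaturality

/-! ### Adjunctions between exact functors and Ext groups -/

section Adjunction

open Abelian

variable {A B : Type (u + 1)} [Category.{u} A] [Abelian A] [HasExt.{u} A]
  [Category.{u} B] [Abelian B] [HasExt.{u} B]
  {F : A ⥤ B} [F.Additive] [PreservesFiniteLimits F] [PreservesFiniteColimits F]
  {G : B ⥤ A} [G.Additive] [PreservesFiniteLimits G] [PreservesFiniteColimits G]

/-- The comparison `Ext(F X, Y) → Ext(X, G Y)` of an adjunction of exact functors is injective. -/
lemma eq_zero_of_unit_comp_mapExactFunctor [EnoughProjectives B] (adj : F ⊣ G) {X : A} {Y : B}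
    {n : ℕ} (ζ : Ext (F.obj X) Y n)
    (h : (Ext.mk₀ (adj.unit.app X)).comp (ζ.mapExactFunctor G) (zero_add n) = 0) : ζ = 0 := by
  -- Naturality of the counit gives `FGζ · ε_Y = ε_{FX} · ζ`. Precompose with `F(η_X)`: the right
  -- side becomes `ζ` by the triangle identity, and the left side vanishes because `F(η_X) · FGζ` is
  -- `F` of the hypothesis.
  have h₁ := mapExactFunctor_naturality (G ⋙ F) (𝟭 B) adj.counit ζ
  rw [mapExactFunctor_functor_comp, mapExactFunctor_id] at h₁
  have h₂ := congrArg (Ext.mapExactFunctor F) h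
  rw [Ext.mapExactFunctor_comp, Ext.mapExactFunctor_mk₀, Ext.mapExactFunctor_zero] at h₂
  have h₃ := congrArg
    (fun γ => (Ext.mk₀ (F.map (adj.unit.app X))).comp γ (zero_add n)) h₁
  have h₄ := congrArg (fun γ => Ext.comp γ (Ext.mk₀ (adj.counit.app Y)) (add_zero n)) h₂
  simp only [Ext.comp_assoc_of_third_deg_zero, Ext.zero_comp] at h₄
  have h₅ := h₃.symm.trans h₄
  simpa using h₅

/-- The comparison `Ext(X, G Y) → Ext(F X, Y)` of an adjunction of exact functors is injective. -/
lemma eq_zero_of_mapExactFunctor_comp_counit [EnoughProjectives A] (adj : F ⊣ G) {X : A} {Y : B}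
    {n : ℕ} (ζ : Ext X (G.obj Y) n)
    (h : (ζ.mapExactFunctor F).comp (Ext.mk₀ (adj.counit.app Y)) (add_zero n) = 0) : ζ = 0 := by
  -- Dually, `ζ · η_{GY} = η_X · GFζ`. Postcomposing with `G(ε_Y)` leaves `ζ` on the left, and on
  -- the right `η_X` times `G` of the hypothesis.
  have h₁ := mapExactFunctor_naturality (𝟭 A) (F ⋙ G) adj.unit ζ
  rw [mapExactFunctor_functor_comp, mapExactFunctor_id] at h₁
  have h₂ := congrArg (Ext.mapExactFunctor G) h
  rw [Ext.mapExactFunctor_comp, Ext.mapExactFunctor_mk₀, Ext.mapExactFunctor_zero] at h₂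
  have h₃ := congrArg
    (fun γ => Ext.comp γ (Ext.mk₀ (G.map (adj.counit.app Y))) (add_zero n)) h₁
  simp only [Ext.comp_assoc_of_third_deg_zero] at h₃
  have h₄ := congrArg (fun γ => (Ext.mk₀ (adj.unit.app X)).comp γ (zero_add n)) h₂
  simp only [Ext.comp_zero] at h₄
  have h₅ := h₃.trans h₄
  simpa using h₅

end Adjunction

/-! ### Elementary properties of the induced maps -/

section ExtMap

open Abelian

variable {C : Type (u + 1)} [Category.{u} C] [Abelian C] [HasExt.{u} C]

lemma extMap_extMap {X X' X'' Y Y' Y'' : C} (f : X' ⟶ X) (f' : X'' ⟶ X') (h : Y ⟶ Y')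
    (h' : Y' ⟶ Y'') {n : ℕ} (ξ : Ext X Y n) :
    extMap f' h' (extMap f h ξ) = extMap (f' ≫ f) (h ≫ h') ξ := by
  simp [extMap]

@[simp] lemma extMap_id {X Y : C} {n : ℕ} (ξ : Ext X Y n) : extMap (𝟙 X) (𝟙 Y) ξ = ξ := by
  simp [extMap]

@[simp] lemma extMap_zero {X X' Y Y' : C} (f : X' ⟶ X) (h : Y ⟶ Y') (n : ℕ) :
    extMap f h (0 : Ext X Y n) = 0 := by
  simp [extMap]

lemma extMap_add {X X' Y Y' : C} (f : X' ⟶ X) (h : Y ⟶ Y') {n : ℕ} (ξ ξ' : Ext X Y n) :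
    extMap f h (ξ + ξ') = extMap f h ξ + extMap f h ξ' := by
  simp [extMap]

lemma extMap_hom_inv_extMap_inv_hom {X X' Y Y' : C} (a : X ≅ X') (b : Y ≅ Y') {n : ℕ}
    (ξ : Ext X Y n) : extMap a.hom b.inv (extMap a.inv b.hom ξ) = ξ := by
  simp [extMap_extMap]

lemma extMap_inv_hom_extMap_hom_inv {X X' Y Y' : C} (a : X ≅ X') (b : Y ≅ Y') {n : ℕ}
    (ξ : Ext X' Y' n) : extMap a.inv b.hom (extMap a.hom b.inv ξ) = ξ := by
  simp [extMap_extMap]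

/-- Yoneda product with a class in `Ext^1(X, Y)` is linear. -/
def yonedaLeftLinear (k : Type u) [Field k] [Linear k C] {X Y : C} (ε : Ext X Y 1) (Z : C)
    (n : ℕ) : ExtPred Y Z n →ₗ[k] Ext X Z n where
  toFun := yonedaLeft ε
  map_add' β β' := by
    cases n
    · exact (add_zero 0).symm
    · exact Ext.comp_add _ _ _ (add_comm 1 _)
  map_smul' c β := by
    cases n
    · exact (smul_zero c).symm
    · exact Ext.comp_smul _ _ (add_comm 1 _) _

/-- Yoneda product with a class in `Ext^1(Y, Z)` is linear. -/
def yonedaRightLinear (k : Type u) [Field k] [Linear k C] {Y Z : C} (ε : Ext Y Z 1) (X : C)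
    (n : ℕ) : ExtPred X Y n →ₗ[k] Ext X Z n where
  toFun := yonedaRight ε
  map_add' β β' := by
    cases n
    · exact (add_zero 0).symm
    · exact Ext.add_comp _ _ _ rfl
  map_smul' c β := by
    cases n
    · exact (smul_zero c).symm
    · exact Ext.smul_comp _ _ rfl _

/-- The hypothesis `h` is what a morphism of extensions provides. Associativity of the Yoneda
product extends it from the class to all products with it. -/
lemma yonedaLeft_extPredMap {X X' Y Y' Z Z' : C} {ε : Ext X Y 1} {ε' : Ext X' Y' 1} {a : X' ⟶ X}
    {b : Y' ⟶ Y}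
    (h : ε'.comp (Ext.mk₀ b) (add_zero 1) = (Ext.mk₀ a).comp ε (zero_add 1)) (c : Z ⟶ Z') {n : ℕ}
    (β : ExtPred Y Z n) : yonedaLeft ε' (extPredMap b c β) = extMap a c (yonedaLeft ε β) := by
  cases n with
  | zero => exact (extMap_zero _ _ _).symm
  | succ n =>
    change Ext Y Z n at β
    change Ext.comp ε' ((Ext.mk₀ b).comp (Ext.comp β (Ext.mk₀ c) (add_zero n)) (zero_add n))
        (add_comm 1 n) =
      (Ext.mk₀ a).comp (Ext.comp (Ext.comp ε β (add_comm 1 n)) (Ext.mk₀ c) (add_zero (n + 1)))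
        (zero_add (n + 1))
    rw [← Ext.comp_assoc_of_second_deg_zero, h, Ext.comp_assoc_of_third_deg_zero]
    exact Ext.comp_assoc _ _ _ _ _ (by lia)

lemma yonedaRight_extPredMap {X X' Y Y' Z Z' : C} {ε : Ext Y Z 1} {ε' : Ext Y' Z' 1} {b : Y ⟶ Y'}
    {c : Z ⟶ Z'}
    (h : ε.comp (Ext.mk₀ c) (add_zero 1) = (Ext.mk₀ b).comp ε' (zero_add 1)) (a : X' ⟶ X) {n : ℕ}
    (β : ExtPred X Y n) : yonedaRight ε' (extPredMap a b β) = extMap a c (yonedaRight ε β) := by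
  cases n with
  | zero => exact (extMap_zero _ _ _).symm
  | succ n =>
    change Ext X Y n at β
    change Ext.comp ((Ext.mk₀ a).comp (Ext.comp β (Ext.mk₀ b) (add_zero n)) (zero_add n)) ε'
        rfl =
      (Ext.mk₀ a).comp (Ext.comp (Ext.comp β ε rfl) (Ext.mk₀ c) (add_zero (n + 1)))
        (zero_add (n + 1))
    rw [Ext.comp_assoc_of_third_deg_zero, h, ← Ext.comp_assoc_of_second_deg_zero β]
    exact Ext.comp_assoc _ _ _ _ _ (by lia)

end ExtMap

/-! ### Splitting the long exact sequences -/

section Splitting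

open Abelian

variable {A B : Type (u + 1)} [Category.{u} A] [Abelian A] [HasExt.{u} A]
  [Category.{u} B] [Abelian B] [HasExt.{u} B]
  {S : A ⥤ B} [S.Additive] [PreservesFiniteLimits S] [PreservesFiniteColimits S]
  {R : B ⥤ A} [R.Additive] [PreservesFiniteLimits R] [PreservesFiniteColimits R]

/-- Naturality of `e.inv` on Ext classes: the composite of `S` and `R` acts on Ext as conjugation by
an isomorphism. It is therefore bijective, and the next two lemmas record the two halves. -/
lemma mapExactFunctor_mapExactFunctor_of_iso [EnoughProjectives A] (e : S ⋙ R ≅ 𝟭 A) {X Y : A}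
    {n : ℕ} (α : Ext X Y n) :
    (α.mapExactFunctor S).mapExactFunctor R = extMap (e.hom.app X) (e.inv.app Y) α := by
  have h := mapExactFunctor_naturality (𝟭 A) (S ⋙ R) e.inv α
  rw [mapExactFunctor_functor_comp, mapExactFunctor_id] at h
  rw [extMap, h]
  simp

lemma exists_mapExactFunctor_mapExactFunctor_eq [EnoughProjectives A] (e : S ⋙ R ≅ 𝟭 A) {X Y : A}
    {n : ℕ} (ρ : Ext (R.obj (S.obj X)) (R.obj (S.obj Y)) n) :
    ∃ α : Ext X Y n, (α.mapExactFunctor S).mapExactFunctor R = ρ :=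
  ⟨extMap (e.inv.app X) (e.hom.app Y) ρ, by
    rw [mapExactFunctor_mapExactFunctor_of_iso e]
    exact extMap_hom_inv_extMap_inv_hom (e.app X) (e.app Y) ρ⟩

lemma eq_zero_of_mapExactFunctor_mapExactFunctor [EnoughProjectives A] (e : S ⋙ R ≅ 𝟭 A) {X Y : A}
    {n : ℕ} {α : Ext X Y n} (h : (α.mapExactFunctor S).mapExactFunctor R = 0) : α = 0 := by
  rw [mapExactFunctor_mapExactFunctor_of_iso e] at h
  rw [← extMap_inv_hom_extMap_hom_inv (e.app X) (e.app Y) α]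
  exact (congrArg _ h).trans (extMap_zero _ _ _)

/-- The left side is the comparison `Ext(M, Z) → Ext(X, R Z)` applied to the pullback of `ξ` along
`p`. Once `η ≫ R.map p` is invertible, this identifies pullback along `p` with the action of `R` on
Ext. -/
lemma mk₀_comp_mapExactFunctor_comp {X : A} {M W Z : B} (η : X ⟶ R.obj M) (p : M ⟶ W) {n : ℕ}
    (ξ : Ext W Z n) :
    (Ext.mk₀ η).comp (((Ext.mk₀ p).comp ξ (zero_add n)).mapExactFunctor R) (zero_add n) =
      (Ext.mk₀ (η ≫ R.map p)).comp (ξ.mapExactFunctor R) (zero_add n) := by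
  simp [Ext.mapExactFunctor_comp, Ext.mapExactFunctor_mk₀]

lemma mapExactFunctor_comp_comp_mk₀ {Y : A} {M W Z : B} (ε : R.obj M ⟶ Y) (i : W ⟶ M) {n : ℕ}
    (ξ : Ext Z W n) :
    ((ξ.comp (Ext.mk₀ i) (add_zero n)).mapExactFunctor R).comp (Ext.mk₀ ε) (add_zero n) =
      (ξ.mapExactFunctor R).comp (Ext.mk₀ (R.map i ≫ ε)) (add_zero n) := by
  simp [Ext.mapExactFunctor_comp, Ext.mapExactFunctor_mk₀]

/-! ### The contravariant sequence: the kernel of `R` on classes out of the quotient `E.X₃`. -/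

section Left

variable {X : A} {E : ShortComplex B} (hE : E.ShortExact) (η : X ⟶ R.obj E.X₂)

/-- Pullback along `E.g` kills products with the class of `E`, as these are consecutive maps of the
long exact sequence. Since `η ≫ R.map E.g` is invertible, `R` kills them too. -/
lemma mapExactFunctor_yonedaLeft (hη : IsIso (η ≫ R.map E.g)) {Z : B} {n : ℕ}
    (β : ExtPred E.X₁ Z n) : (yonedaLeft hE.extClass β).mapExactFunctor R = 0 := by
  have h : (Ext.mk₀ E.g).comp (yonedaLeft hE.extClass β) (zero_add n) = 0 := by
    cases n with
    | zero => exact Ext.comp_zero _ _ _ _ (zero_add 0)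
    | succ n => exact hE.comp_extClass_assoc (Y := Z) β (add_comm 1 n)
  have h' := mk₀_comp_mapExactFunctor_comp η E.g (yonedaLeft hE.extClass β)
  rw [h, Ext.mapExactFunctor_zero, Ext.comp_zero] at h'
  have h'' := congrArg
    (fun γ => (Ext.mk₀ (inv (η ≫ R.map E.g))).comp γ (zero_add n)) h'
  simpa using h''.symm

/-- If `R` kills `ξ`, the comparison kills the pullback of `ξ` along `E.g`. By injectivity this
pullback is zero, and exactness at `Ext(E.X₃, Z)` gives `β`. -/
lemma exists_yonedaLeft_eq
    (hinj : ∀ {Z : B} {n : ℕ} (ζ : Ext E.X₂ Z n),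
      (Ext.mk₀ η).comp (ζ.mapExactFunctor R) (zero_add n) = 0 → ζ = 0)
    {Z : B} {n : ℕ} (ξ : Ext E.X₃ Z n) (h : ξ.mapExactFunctor R = 0) :
    ∃ β : ExtPred E.X₁ Z n, yonedaLeft hE.extClass β = ξ := by
  have hξ : (Ext.mk₀ E.g).comp ξ (zero_add n) = 0 := hinj _ (by
    rw [mk₀_comp_mapExactFunctor_comp, h, Ext.comp_zero])
  cases n with
  -- There is no preceding Ext group in degree zero; instead `E.g` is an epimorphism, so `ξ` itself
  -- is zero.
  | zero =>
    have : Epi E.g := hE.epi_g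
    refine ⟨PUnit.unit, (Ext.precomp_mk₀_injective_of_epi Z E.g ?_).symm⟩
    exact hξ.trans (map_zero ((Ext.mk₀ E.g).precomp Z (zero_add 0))).symm
  | succ n => exact Ext.contravariant_sequence_exact₃ hE Z ξ hξ (add_comm 1 n)

/-- A class killed by the connecting map is the restriction of some `γ` on `E.X₂`. Surjectivity of
`R` makes `γ` a pullback from `E.X₃`, and such classes restrict to zero on `E.X₁`. -/
lemma yonedaLeft_eq_zero (hη : IsIso (η ≫ R.map E.g))
    (hinj : ∀ {Z : B} {n : ℕ} (ζ : Ext E.X₂ Z n),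
      (Ext.mk₀ η).comp (ζ.mapExactFunctor R) (zero_add n) = 0 → ζ = 0)
    {Z : B} (hsurj : ∀ {n : ℕ} (ρ : Ext (R.obj E.X₃) (R.obj Z) n),
      ∃ δ : Ext E.X₃ Z n, δ.mapExactFunctor R = ρ)
    {n : ℕ} (β : ExtPred E.X₁ Z n) (h : yonedaLeft hE.extClass β = 0) : β = 0 := by
  cases n with
  | zero => rfl
  | succ n =>
    obtain ⟨γ, rfl⟩ := Ext.contravariant_sequence_exact₁ hE Z β (add_comm 1 n) h
    -- The class on the right is chosen so that pulling it back along `η ≫ R.map E.g` gives the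
    -- comparison of `γ`. Hence `γ` and the pullback of `δ` along `E.g` have the same comparison,
    -- and injectivity identifies them.
    obtain ⟨δ, hδ⟩ := hsurj
      ((Ext.mk₀ (inv (η ≫ R.map E.g) ≫ η)).comp (γ.mapExactFunctor R) (zero_add n))
    have hγ : (Ext.mk₀ E.g).comp δ (zero_add n) + -γ = 0 := hinj _ (by
      rw [Ext.mapExactFunctor_add, Ext.comp_add, mk₀_comp_mapExactFunctor_comp, hδ,
        Ext.mk₀_comp_mk₀_assoc, IsIso.hom_inv_id_assoc, ← Ext.comp_add,
        ← Ext.mapExactFunctor_add, add_neg_cancel, Ext.mapExactFunctor_zero, Ext.comp_zero])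
    rw [← eq_neg_of_add_eq_zero_left hγ |>.trans (neg_neg γ)]
    change (Ext.mk₀ E.f).comp ((Ext.mk₀ E.g).comp δ (zero_add n)) (zero_add n) = 0
    rw [Ext.mk₀_comp_mk₀_assoc, E.zero, Ext.mk₀_zero, Ext.zero_comp]

end Left

/-! ### The covariant sequence: the kernel of `R` on classes into the subobject `E.X₁`. -/

section Right

variable {Y : A} {E : ShortComplex B} (hE : E.ShortExact) (ε : R.obj E.X₂ ⟶ Y)

/-- Dual to `mapExactFunctor_yonedaLeft`: pushforward along `E.f` kills products with the class, and
it detects the action of `R` because `R.map E.f ≫ ε` is invertible. -/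
lemma mapExactFunctor_yonedaRight (hε : IsIso (R.map E.f ≫ ε)) {Z : B} {n : ℕ}
    (β : ExtPred Z E.X₃ n) : (yonedaRight hE.extClass β).mapExactFunctor R = 0 := by
  have h : (yonedaRight hE.extClass β).comp (Ext.mk₀ E.f) (add_zero n) = 0 := by
    cases n with
    | zero => exact map_zero ((Ext.mk₀ E.f).postcomp Z (add_zero 0))
    | succ n =>
      change Ext Z E.X₃ n at β
      refine (Ext.comp_assoc_of_third_deg_zero β hE.extClass (Ext.mk₀ E.f) rfl).trans ?_
      rw [hE.extClass_comp, Ext.comp_zero]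
  have h' := mapExactFunctor_comp_comp_mk₀ ε E.f (yonedaRight hE.extClass β)
  rw [h, Ext.mapExactFunctor_zero, Ext.zero_comp] at h'
  have h'' := congrArg
    (fun γ => Ext.comp γ (Ext.mk₀ (inv (R.map E.f ≫ ε))) (add_zero n)) h'
  simpa using h''.symm

lemma exists_yonedaRight_eq
    (hinj : ∀ {Z : B} {n : ℕ} (ζ : Ext Z E.X₂ n),
      (ζ.mapExactFunctor R).comp (Ext.mk₀ ε) (add_zero n) = 0 → ζ = 0)
    {Z : B} {n : ℕ} (ξ : Ext Z E.X₁ n) (h : ξ.mapExactFunctor R = 0) :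
    ∃ β : ExtPred Z E.X₃ n, yonedaRight hE.extClass β = ξ := by
  have hξ : ξ.comp (Ext.mk₀ E.f) (add_zero n) = 0 := hinj _ (by
    rw [mapExactFunctor_comp_comp_mk₀, h, Ext.zero_comp])
  cases n with
  | zero =>
    have : Mono E.f := hE.mono_f
    refine ⟨PUnit.unit, (Ext.postcomp_mk₀_injective_of_mono Z E.f ?_).symm⟩
    exact hξ.trans (map_zero ((Ext.mk₀ E.f).postcomp Z (add_zero 0))).symm
  | succ n => exact Ext.covariant_sequence_exact₁ Z hE ξ hξ rfl

lemma yonedaRight_eq_zero (hε : IsIso (R.map E.f ≫ ε))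
    (hinj : ∀ {Z : B} {n : ℕ} (ζ : Ext Z E.X₂ n),
      (ζ.mapExactFunctor R).comp (Ext.mk₀ ε) (add_zero n) = 0 → ζ = 0)
    {Z : B} (hsurj : ∀ {n : ℕ} (ρ : Ext (R.obj Z) (R.obj E.X₁) n),
      ∃ δ : Ext Z E.X₁ n, δ.mapExactFunctor R = ρ)
    {n : ℕ} (β : ExtPred Z E.X₃ n) (h : yonedaRight hE.extClass β = 0) : β = 0 := by
  cases n with
  | zero => rfl
  | succ n =>
    obtain ⟨γ, rfl⟩ := Ext.covariant_sequence_exact₃ Z hE β rfl h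
    -- Chosen so that the pushforward of `δ` along `E.f` has the same comparison as `γ`; then `γ`
    -- comes from `E.X₁` and its image in `E.X₃` is zero.
    obtain ⟨δ, hδ⟩ := hsurj
      ((γ.mapExactFunctor R).comp (Ext.mk₀ (ε ≫ inv (R.map E.f ≫ ε))) (add_zero n))
    have hγ : δ.comp (Ext.mk₀ E.f) (add_zero n) + -γ = 0 := hinj _ (by
      rw [Ext.mapExactFunctor_add, Ext.add_comp, mapExactFunctor_comp_comp_mk₀, hδ,
        Ext.comp_assoc_of_third_deg_zero, Ext.mk₀_comp_mk₀, Category.assoc, IsIso.inv_hom_id,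
        Category.comp_id, ← Ext.add_comp, ← Ext.mapExactFunctor_add, add_neg_cancel,
        Ext.mapExactFunctor_zero, Ext.zero_comp])
    rw [← eq_neg_of_add_eq_zero_left hγ |>.trans (neg_neg γ)]
    change (δ.comp (Ext.mk₀ E.f) (add_zero n)).comp (Ext.mk₀ E.g) (add_zero n) = 0
    rw [Ext.comp_assoc_of_third_deg_zero, Ext.mk₀_comp_mk₀, E.zero, Ext.mk₀_zero, Ext.comp_zero]

end Right

/-- If `r` vanishes exactly on the range of `j`, `j` is injective and `r ∘ s` is bijective, then
`s` and `j` exhibit their target as a direct sum. -/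
lemma bijective_coprod {k V W P Q : Type*} [Field k] [AddCommGroup V] [Module k V]
    [AddCommGroup W] [Module k W] [AddCommGroup P] [Module k P] [AddCommGroup Q]
    (s : V →ₗ[k] P) (j : W →ₗ[k] P) (r : P →+ Q) (hrj : ∀ w, r (j w) = 0)
    (hr : ∀ p, r p = 0 → ∃ w, j w = p) (hj : ∀ w, j w = 0 → w = 0)
    (hs : ∀ v, r (s v) = 0 → v = 0) (hs' : ∀ q, ∃ v, r (s v) = q) :
    Function.Bijective (s.coprod j) := by
  constructor
  · refine (injective_iff_map_eq_zero _).2 ?_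
    rintro ⟨v, w⟩ h
    rw [LinearMap.coprod_apply] at h
    have hv : v = 0 := hs v (by simpa [hrj] using congrArg r h)
    subst hv
    rw [map_zero, zero_add] at h
    rw [hj w h]
    rfl
  · intro p
    obtain ⟨v, hv⟩ := hs' (r p)
    -- Removing the `s`-component puts the rest in the kernel of `r`, which is the range of `j`.
    obtain ⟨w, hw⟩ := hr (p - s v) (by rw [map_sub, hv, sub_self])
    exact ⟨(v, w), by simp [hw]⟩

variable (k : Type u) [Field k] [Linear k A] [Linear k B] [S.Linear k]

/-- The decomposition of `Ext(S X, S Y)` from an extension of `S X` whose middle term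
corepresents `Ext(X, R -)`. -/
lemma bijective_mapExt_coprod_yonedaLeft [EnoughProjectives A] (e : S ⋙ R ≅ 𝟭 A) {X : A}
    {T M : B} {i : T ⟶ M} {p : M ⟶ S.obj X} {w : i ≫ p = 0}
    (hE : (ShortComplex.mk i p w).ShortExact) (η : X ⟶ R.obj M) (hη : IsIso (η ≫ R.map p))
    (hinj : ∀ {Z : B} {n : ℕ} (ζ : Ext M Z n),
      (Ext.mk₀ η).comp (ζ.mapExactFunctor R) (zero_add n) = 0 → ζ = 0) (Y : A) (n : ℕ) :
    Function.Bijective ((S.mapExtLinearMap k X Y n).coprod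
      (yonedaLeftLinear k hE.extClass (S.obj Y) n)) :=
  -- The detecting map is `R` on Ext, for which additivity suffices. Its surjectivity, needed for
  -- the injectivity of the Yoneda product, uses that the second argument is also of the form `S.obj
  -- Y`: a preimage is `S` of a class.
  bijective_coprod _ _ (R.mapExtAddHom (S.obj X) (S.obj Y) n)
    (mapExactFunctor_yonedaLeft hE η hη) (exists_yonedaLeft_eq hE η hinj)
    (yonedaLeft_eq_zero hE η hη hinj fun ρ =>
      (exists_mapExactFunctor_mapExactFunctor_eq e ρ).imp' _ fun _ h => h)
    (fun _ => eq_zero_of_mapExactFunctor_mapExactFunctor e)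
    (exists_mapExactFunctor_mapExactFunctor_eq e)

/-- The decomposition of `Ext(S X, S Y)` from an extension by `S Y` whose middle term
represents `Ext(R -, Y)`. -/
lemma bijective_mapExt_coprod_yonedaRight [EnoughProjectives A] (e : S ⋙ R ≅ 𝟭 A) {Y : A}
    {T M : B} {i : S.obj Y ⟶ M} {p : M ⟶ T} {w : i ≫ p = 0}
    (hE : (ShortComplex.mk i p w).ShortExact) (ε : R.obj M ⟶ Y) (hε : IsIso (R.map i ≫ ε))
    (hinj : ∀ {Z : B} {n : ℕ} (ζ : Ext Z M n),
      (ζ.mapExactFunctor R).comp (Ext.mk₀ ε) (add_zero n) = 0 → ζ = 0) (X : A) (n : ℕ) :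
    Function.Bijective ((S.mapExtLinearMap k X Y n).coprod
      (yonedaRightLinear k hE.extClass (S.obj X) n)) :=
  bijective_coprod _ _ (R.mapExtAddHom (S.obj X) (S.obj Y) n)
    (mapExactFunctor_yonedaRight hE ε hε) (exists_yonedaRight_eq hE ε hinj)
    (yonedaRight_eq_zero hE ε hε hinj fun ρ =>
      (exists_mapExactFunctor_mapExactFunctor_eq e ρ).imp' _ fun _ h => h)
    (fun _ => eq_zero_of_mapExactFunctor_mapExactFunctor e)
    (exists_mapExactFunctor_mapExactFunctor_eq e)

end Splitting

/-! ### The adjoint triple `lext ⊣ down ⊣ rext` -/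

section AdjointTriple

instance {k h : Type u} [Field k] [LieRing h] [LieAlgebra k h] : EnoughProjectives (LieMod k h) :=
  LieMod.toEnv.asEquivalence.enoughProjectives_iff.2 ModuleCat.enoughProjectives

instance {k g : Type u} [Field k] [NonUnitalNonAssocRing g] [Module k g] :
    EnoughProjectives (LeibMod k g) :=
  LeibMod.toEnv.asEquivalence.enoughProjectives_iff.2 ModuleCat.enoughProjectives

/-! ### The elements `x m + m x` of a `g`-module. -/

section Anticommutator

variable {k g : Type u} [Field k] [NonUnitalNonAssocRing g] [Module k g]

/-- The linear map `M ⊗ g → M`, `m ⊗ x ↦ x m + m x`. -/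
def anticomm (M : LeibMod k g) : M.carrier ⊗[k] g →ₗ[k] M.carrier :=
  TensorProduct.lift (M.left + M.right).flip

@[simp] lemma anticomm_tmul (M : LeibMod k g) (m : M.carrier) (x : g) :
    anticomm M (m ⊗ₜ x) = M.left x m + M.right x m := rfl

/-- The right sides of `lml` and `llm` are opposite, so `x (m y) + x (y m) = 0`. This is why the
kernel of `lext N → N^s` is antisymmetric. -/
lemma left_anticomm (M : LeibMod k g) (x : g) (t : M.carrier ⊗[k] g) :
    M.left x (anticomm M t) = 0 := by
  induction t with
  | zero => simp
  | add s t hs ht => simp [hs, ht]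
  | tmul m y => simp [M.lml, M.llm]

/-- With `left_anticomm`, this makes `anticomm` a morphism of `g`-modules from `(M^↓ ⊗ g^↓)^a` to
`M`, the nontrivial component of `lextCounit`. -/
lemma right_anticomm [IsScalarTower k g g] (M : LeibMod k g) (x : g) (t : M.carrier ⊗[k] g) :
    M.right x (anticomm M t) = anticomm M
      ((M.right x).rTensor g t + (LinearMap.mulRight k x).lTensor M.carrier t) := by
  induction t with
  | zero => simp
  | add s t hs ht => simp only [map_add, hs, ht]; abel
  | tmul m y =>
    simp only [anticomm_tmul, map_add, LinearMap.rTensor_tmul, LinearMap.lTensor_tmul,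
      LinearMap.mulRight_apply, M.lml, M.mll]
    abel

lemma anticomm_rTensor {M M' : LeibMod k g} (f : M ⟶ M') (t : M.carrier ⊗[k] g) :
    anticomm M' (f.lin.rTensor g t) = f.lin (anticomm M t) := by
  induction t with
  | zero => simp
  | add s t hs ht => simp only [map_add, hs, ht]
  | tmul m y => simp [f.map_left, f.map_right]

end Anticommutator

variable (k g : Type u) [Field k] [NonUnitalNonAssocRing g] [Module k g]
  [IsScalarTower k g g] [SMulCommClass k g g] [IsLeibniz g]

instance : (sym k g).Linear k where
  map_smul _ _ := rfl

instance : (asym k g).Linear k where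
  map_smul _ _ := rfl

instance : (down k g).Additive where
  map_add := rfl

lemma down_exact : PreservesFiniteLimits (down k g) ∧ PreservesFiniteColimits (down k g) :=
  ((down k g).exact_tfae.out 0 3).1 fun S hS =>
    (LieMod.shortExact_iff _).2 ((LeibMod.shortExact_iff S).1 hS)

instance : PreservesFiniteLimits (down k g) := (down_exact k g).1
instance : PreservesFiniteColimits (down k g) := (down_exact k g).2

variable {k g} in
/-- A linear map that is compatible with the actions of the elements of `g`. -/
def lieHomMk {M N : LieMod k (GLie k g)} (f : M.carrier →ₗ[k] N.carrier)
    (hf : ∀ (x : g) (m : M.carrier), f (M.act (toLie k g x) m) = N.act (toLie k g x) (f m)) :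
    M ⟶ N :=
  ⟨f, fun x m => by
    obtain ⟨x, rfl⟩ := toLie_surjective k g x
    exact hf x m⟩

/-- The symmetric module `N^s` restricts to `N`. -/
def symCompDown : sym k g ⋙ down k g ≅ 𝟭 _ :=
  NatIso.ofComponents (fun N =>
    { hom := lieHomMk (M := (down k g).obj ((sym k g).obj N)) (N := N) LinearMap.id
        fun _ _ => rfl
      inv := lieHomMk (N := (down k g).obj ((sym k g).obj N)) (M := N) LinearMap.id
        fun _ _ => rfl
      hom_inv_id := rfl
      inv_hom_id := rfl }) fun _ => rfl

/-- The antisymmetric module `N^a` restricts to `N`. -/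
def asymCompDown : asym k g ⋙ down k g ≅ 𝟭 _ :=
  NatIso.ofComponents (fun N =>
    { hom := lieHomMk (M := (down k g).obj ((asym k g).obj N)) (N := N) LinearMap.id
        fun _ _ => rfl
      inv := lieHomMk (N := (down k g).obj ((asym k g).obj N)) (M := N) LinearMap.id
        fun _ _ => rfl
      hom_inv_id := rfl
      inv_hom_id := rfl }) fun _ => rfl

/-! ### The exact left adjoint `lext` of `down`. -/

variable {k g} in
/-- The map `lext N → lext N'` induced by `f : N → N'`. -/
def lextMap {N N' : LieMod k (GLie k g)} (f : N ⟶ N') : lext N ⟶ lext N' where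
  lin := (f.lin.rTensor g).prodMap f.lin
  map_left x p := Prod.ext (by rfl) (by
    change f.lin (-N.act (toLie k g x) p.2) = -N'.act (toLie k g x) (f.lin p.2)
    rw [map_neg, f.map_act])
  map_right x p := Prod.ext (rTensor_tensorAct (gDown k g) f (toLie k g x) p.1)
    (f.map_act _ _)

/-- The functor `N ↦ lext N`. -/
def lextFunctor : LieMod k (GLie k g) ⥤ LeibMod k g where
  obj N := lext N
  map f := lextMap f
  map_id N := LeibMod.hom_ext (by
    change ((LinearMap.id.rTensor g).prodMap LinearMap.id) = LinearMap.id
    rw [LinearMap.rTensor_id, LinearMap.prodMap_id])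
  map_comp {N N' N''} f f' := LeibMod.hom_ext (by
    change (((f'.lin ∘ₗ f.lin).rTensor g).prodMap (f'.lin ∘ₗ f.lin)) =
      ((f'.lin.rTensor g).prodMap f'.lin) ∘ₗ ((f.lin.rTensor g).prodMap f.lin)
    rw [LinearMap.rTensor_comp, LinearMap.prodMap_comp])

instance : (lextFunctor k g).Additive where
  map_add {N N' f f'} := LeibMod.hom_ext (by
    change (((f.lin + f'.lin).rTensor g).prodMap (f.lin + f'.lin)) =
      ((f.lin.rTensor g).prodMap f.lin) + ((f'.lin.rTensor g).prodMap f'.lin)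
    rw [LinearMap.rTensor_add]
    rfl)

variable {k g} in
lemma shortExact_prodMap {V V' V'' W W' W'' : Type u} [AddCommGroup V] [Module k V]
    [AddCommGroup V'] [Module k V'] [AddCommGroup V''] [Module k V''] [AddCommGroup W]
    [Module k W] [AddCommGroup W'] [Module k W'] [AddCommGroup W''] [Module k W'']
    {f : V →ₗ[k] V'} {f' : V' →ₗ[k] V''} {h : W →ₗ[k] W'} {h' : W' →ₗ[k] W''}
    (H : Function.Injective f ∧ Function.Exact f f' ∧ Function.Surjective f')
    (H' : Function.Injective h ∧ Function.Exact h h' ∧ Function.Surjective h') :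
    Function.Injective (f.prodMap h) ∧ Function.Exact (f.prodMap h) (f'.prodMap h') ∧
      Function.Surjective (f'.prodMap h') := by
  refine ⟨H.1.prodMap H'.1, ?_, H.2.2.prodMap H'.2.2⟩
  rintro ⟨v, w⟩
  simp only [LinearMap.prodMap_apply, Prod.mk_eq_zero, H.2.1 v, H'.2.1 w, Set.mem_range,
    Prod.exists, Prod.mk.injEq]
  exact ⟨fun ⟨⟨a, ha⟩, b, hb⟩ => ⟨a, b, ha, hb⟩, fun ⟨a, b, ha, hb⟩ => ⟨⟨a, ha⟩, b, hb⟩⟩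

/-- The underlying space is `(N ⊗ g) ⊕ N`, and tensoring over a field is exact. -/
lemma lextFunctor_exact : PreservesFiniteLimits (lextFunctor k g) ∧
    PreservesFiniteColimits (lextFunctor k g) :=
  ((lextFunctor k g).exact_tfae.out 0 3).1 fun S hS => (LeibMod.shortExact_iff _).2 (by
    have H := (LieMod.shortExact_iff S).1 hS
    exact shortExact_prodMap
      ⟨Module.Flat.rTensor_preserves_injective_linearMap _ H.1,
        rTensor_exact g H.2.1 H.2.2, LinearMap.rTensor_surjective g H.2.2⟩ H)

instance : PreservesFiniteLimits (lextFunctor k g) := (lextFunctor_exact k g).1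
instance : PreservesFiniteColimits (lextFunctor k g) := (lextFunctor_exact k g).2

variable {k g} in
/-- The inclusion of `N ⊗ g` in `lext N`. -/
def lextInl (N : LieMod k (GLie k g)) : N.carrier ⊗[k] g →ₗ[k] (lext N).carrier :=
  LinearMap.inl k (N.carrier ⊗[k] g) N.carrier

variable {k g} in
/-- The inclusion of `N` in `lext N`. -/
def lextInr (N : LieMod k (GLie k g)) : N.carrier →ₗ[k] (lext N).carrier :=
  LinearMap.inr k (N.carrier ⊗[k] g) N.carrier

variable {k g} in
/-- The inclusion `N → (lext N)^↓`. -/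
def lextUnit (N : LieMod k (GLie k g)) : N ⟶ (down k g).obj (lext N) :=
  lieHomMk (M := N) (N := downObj (lext N)) (lextInr N) fun x n => by
    change ((0 : N.carrier ⊗[k] g), _) = lextRight N x (0, n)
    simp

variable {k g} in
/-- The action `lext (M^↓) → M`. -/
def lextCounit (M : LeibMod k g) : lext ((down k g).obj M) ⟶ M where
  lin := (anticomm M).coprod LinearMap.id
  map_left x p := by
    obtain ⟨(t : M.carrier ⊗[k] g), (m : M.carrier)⟩ := p
    -- The terms `m x` cancel and leave `x m`; on the other side `x` annihilates `anticomm M t`.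
    change anticomm M (m ⊗ₜ x) + -M.right x m = M.left x (anticomm M t + m)
    simp [left_anticomm]
  map_right x p := by
    obtain ⟨(t : M.carrier ⊗[k] g), (m : M.carrier)⟩ := p
    change anticomm M ((M.right x).rTensor g t + (LinearMap.mulRight k x).lTensor M.carrier t)
      + M.right x m = M.right x (anticomm M t + m)
    rw [map_add (M.right x), right_anticomm]

-- In `lext N`, an element `m` of the summand `N` satisfies `y m = (m ⊗ y, -m y)` and `m y = (0, m
-- y)`, with sum `m ⊗ y`. Thus `N` generates `lext N`, which is the content of the left triangle
-- identity.
variable {k g} in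
lemma anticomm_lext (N : LieMod k (GLie k g)) (t : N.carrier ⊗[k] g) :
    anticomm (lext N) ((lextInr N).rTensor g t) = lextInl N t := by
  induction t with
  | zero => rw [map_zero, map_zero, map_zero]
  | add s t hs ht => rw [map_add, map_add, map_add, hs, ht]
  | tmul m y =>
    change lextLeft N y (0, m) + lextRight N y (0, m) = (m ⊗ₜ y, 0)
    simp

/-- `lext` is left adjoint to the restriction to the right action. -/
def lextAdjunction : lextFunctor k g ⊣ down k g :=
  Adjunction.mkOfUnitCounit
    { unit :=
        { app := fun N => lextUnit N
          naturality := fun N N' f => LieMod.hom_ext (LinearMap.ext fun n => by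
            change ((0 : N'.carrier ⊗[k] g), f.lin n) = (f.lin.rTensor g 0, f.lin n)
            rw [map_zero]) }
      counit :=
        { app := fun M => lextCounit M
          naturality := fun M M' f => LeibMod.hom_ext (LinearMap.ext fun p => by
            obtain ⟨(t : M.carrier ⊗[k] g), (m : M.carrier)⟩ := p
            change anticomm M' (f.lin.rTensor g t) + f.lin m = f.lin (anticomm M t + m)
            rw [map_add, anticomm_rTensor]) }
      left_triangle := by
        ext N : 2
        refine LeibMod.hom_ext (LinearMap.ext fun p => ?_)
        obtain ⟨t, n⟩ := p
        change anticomm (lext N) ((lextInr N).rTensor g t) + lextInr N n = (t, n)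
        rw [anticomm_lext]
        exact Prod.ext (add_zero t) (zero_add n)
      right_triangle := by
        ext M : 2
        refine LieMod.hom_ext (LinearMap.ext fun (m : M.carrier) => ?_)
        change anticomm M 0 + m = m
        simp }

/-! ### The exact right adjoint `rext` of `down`. -/

variable {k g} in
/-- The map `rext N → rext N'` induced by `f : N → N'`. -/
def rextMap {N N' : LieMod k (GLie k g)} (f : N ⟶ N') : rext N ⟶ rext N' where
  lin := f.lin.prodMap (LinearMap.llcomp k g N.carrier N'.carrier f.lin)
  map_left x p := Prod.ext (by rfl) 
    ((LinearMap.comp_neg _ _).trans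
      (congrArg Neg.neg (comp_homAct (gDown k g) f (toLie k g x) p.2)))
  map_right x p := Prod.ext (f.map_act _ _) (comp_homAct (gDown k g) f (toLie k g x) p.2)

/-- The functor `N ↦ rext N`. -/
def rextFunctor : LieMod k (GLie k g) ⥤ LeibMod k g where
  obj N := rext N
  map f := rextMap f

instance : (rextFunctor k g).Additive where
  map_add := LeibMod.hom_ext (LinearMap.ext fun _ =>
    Prod.ext rfl (LinearMap.ext fun _ => rfl))

/-- The underlying space is `N ⊕ Hom_k(g, N)`, and `Hom_k(g, -)` is exact over a field. -/
lemma rextFunctor_exact : PreservesFiniteLimits (rextFunctor k g) ∧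
    PreservesFiniteColimits (rextFunctor k g) :=
  ((rextFunctor k g).exact_tfae.out 0 3).1 fun S hS => (LeibMod.shortExact_iff _).2 (by
    have H := (LieMod.shortExact_iff S).1 hS
    refine shortExact_prodMap H ⟨fun a b hab => ?_, fun φ => ⟨fun hφ => ?_, ?_⟩, fun φ => ?_⟩
    · exact LinearMap.ext fun x => H.1 (LinearMap.congr_fun hab x)
    -- A linear retraction of the injection lifts `φ`, whose values lie in the range of `S.f`; the
    -- retraction need not respect the action.
    · obtain ⟨r, hr⟩ := LinearMap.exists_leftInverse_of_injective S.f.lin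
        (LinearMap.ker_eq_bot.2 H.1)
      refine ⟨r ∘ₗ φ, LinearMap.ext fun x => ?_⟩
      obtain ⟨y, hy⟩ := (H.2.1 (φ x)).1 (LinearMap.congr_fun hφ x)
      change S.f.lin (r (φ x)) = φ x
      rw [← hy]
      exact congrArg S.f.lin (LinearMap.congr_fun hr y)
    · rintro ⟨ψ, rfl⟩
      exact LinearMap.ext fun x => H.2.1.apply_apply_eq_zero (ψ x)
    · exact Module.projective_lifting_property _ φ H.2.2)

instance : PreservesFiniteLimits (rextFunctor k g) := (rextFunctor_exact k g).1
instance : PreservesFiniteColimits (rextFunctor k g) := (rextFunctor_exact k g).2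

variable {k g} in
/-- The projection `(rext N)^↓ → N`. -/
def rextCounit (N : LieMod k (GLie k g)) : (down k g).obj (rext N) ⟶ N :=
  lieHomMk (M := downObj (rext N)) (N := N) (LinearMap.fst k N.carrier (g →ₗ[k] N.carrier))
    fun _ _ => rfl

variable {k g} in
/-- The coaction `M → rext (M^↓)`, `m ↦ (m, x ↦ x m)`. -/
def rextUnit (M : LeibMod k g) : M ⟶ rext ((down k g).obj M) where
  lin := LinearMap.id.prod M.left.flip
  -- In the `Hom` component, compatibility with the left action is the relation `llm`, and
  -- compatibility with the right action is `lml`.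
  map_left x m := Prod.ext (by rfl) (LinearMap.ext fun y => by
    change M.left y (M.left x m) = -(M.right x (M.left y m) - M.left (y * x) m)
    rw [M.llm]
    abel)
  map_right x m := Prod.ext (by rfl) (LinearMap.ext fun y => M.lml y x m)

/-- `rext` is right adjoint to the restriction to the right action. -/
def rextAdjunction : down k g ⊣ rextFunctor k g :=
  Adjunction.mkOfUnitCounit
    { unit :=
        { app := fun M => rextUnit M
          naturality := fun M M' f => LeibMod.hom_ext (LinearMap.ext fun m =>
            Prod.ext rfl (LinearMap.ext fun x => (f.map_left x m).symm)) }
      counit :=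
        { app := fun N => rextCounit N
          naturality := fun _ _ _ => rfl }
      left_triangle := by
        ext M : 2
        rfl
      right_triangle := by
        ext N : 2
        rfl }

/-! ### Naturality of the two extensions -/

variable {k g}

/-- The morphism of extensions `lext N → lext N'` induced by `f : N → N'`. -/
def lextSeqMap {N N' : LieMod k (GLie k g)} (f : N ⟶ N') : lextSeq N ⟶ lextSeq N' where
  τ₁ := (asym k g).map ((tensorRight (gDown k g)).map f)
  τ₂ := lextMap f
  τ₃ := (sym k g).map f
  comm₁₂ := LeibMod.hom_ext (LinearMap.ext fun t => by
    change (f.lin.rTensor g t, (0 : N'.carrier)) = (f.lin.rTensor g t, f.lin 0)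
    rw [map_zero])
  comm₂₃ := rfl

/-- The morphism of extensions `rext N → rext N'` induced by `f : N → N'`. -/
def rextSeqMap {N N' : LieMod k (GLie k g)} (f : N ⟶ N') : rextSeq N ⟶ rextSeq N' where
  τ₁ := (asym k g).map f
  τ₂ := rextMap f
  τ₃ := (sym k g).map ((homRight (gDown k g)).map f)
  comm₁₂ := LeibMod.hom_ext (LinearMap.ext fun t => Prod.ext rfl (LinearMap.ext fun x => by
    exact (map_zero f.lin).symm))
  comm₂₃ := rfl

lemma lextClass_naturality {N N' : LieMod k (GLie k g)} (f : N ⟶ N') :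
    (lextClass N).comp (Abelian.Ext.mk₀ ((asym k g).map ((tensorRight (gDown k g)).map f)))
      (add_zero 1) = (Abelian.Ext.mk₀ ((sym k g).map f)).comp (lextClass N') (zero_add 1) :=
  ShortComplex.ShortExact.extClass_naturality (lextSeq_shortExact N) (lextSeq_shortExact N')
    (lextSeqMap f)

lemma rextClass_naturality {N N' : LieMod k (GLie k g)} (f : N ⟶ N') :
    (rextClass N).comp (Abelian.Ext.mk₀ ((asym k g).map f)) (add_zero 1) =
      (Abelian.Ext.mk₀ ((sym k g).map ((homRight (gDown k g)).map f))).comp (rextClass N')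
        (zero_add 1) :=
  ShortComplex.ShortExact.extClass_naturality (rextSeq_shortExact N) (rextSeq_shortExact N')
    (rextSeqMap f)

end AdjointTriple

/-! ### The decompositions of the Ext groups -/

section Decomposition

open Abelian

variable {k g : Type u} [Field k] [NonUnitalNonAssocRing g] [Module k g]
  [IsScalarTower k g g] [SMulCommClass k g g] [IsLeibniz g]

lemma bijective_sym_coprod_lextClass (N₁ N₂ : LieMod k (GLie k g)) (n : ℕ) :
    Function.Bijective (((sym k g).mapExtLinearMap k N₁ N₂ n).coprod
      (yonedaLeftLinear k (lextClass N₁) ((sym k g).obj N₂) n)) :=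
  bijective_mapExt_coprod_yonedaLeft k (symCompDown k g) (lextSeq_shortExact N₁) (lextUnit N₁)
    -- The composite `N₁ → (lext N₁)^↓ → (N₁^s)^↓` sends `n` to `(0, n)` and then to `n`, so it is
    -- the inverse of the canonical isomorphism.
    (inferInstanceAs (IsIso ((symCompDown k g).inv.app N₁)))
    (fun ζ h => eq_zero_of_unit_comp_mapExactFunctor (lextAdjunction k g) (X := N₁) ζ h) N₂ n

lemma bijective_asym_coprod_rextClass (N₁ N₂ : LieMod k (GLie k g)) (n : ℕ) :
    Function.Bijective (((asym k g).mapExtLinearMap k N₁ N₂ n).coprod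
      (yonedaRightLinear k (rextClass N₂) ((asym k g).obj N₁) n)) :=
  bijective_mapExt_coprod_yonedaRight k (asymCompDown k g) (rextSeq_shortExact N₂) (rextCounit N₂)
    -- Here `(N₂^a)^↓ → (rext N₂)^↓ → N₂` sends `n` to `(n, 0)` and then to `n`.
    (inferInstanceAs (IsIso ((asymCompDown k g).hom.app N₂)))
    (fun ζ h => eq_zero_of_mapExactFunctor_comp_counit (rextAdjunction k g) (Y := N₂) ζ h) N₁ n

/-- `Ext(N₁^s, N₂^s) ≅ Ext(N₁, N₂) ⊕ Ext((N₁ ⊗ g^↓)^a, N₂^s)[-1]`. -/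
def symExtEquiv (N₁ N₂ : LieMod k (GLie k g)) (n : ℕ) :
    Ext ((sym k g).obj N₁) ((sym k g).obj N₂) n ≃ₗ[k]
      Ext N₁ N₂ n ×
        ExtPred ((asym k g).obj ((tensorRight (gDown k g)).obj N₁)) ((sym k g).obj N₂) n :=
  -- The explicit map is the one out of the direct sum, so the formula for the inverse of this
  -- equivalence holds by definition.
  (LinearEquiv.ofBijective _ (bijective_sym_coprod_lextClass N₁ N₂ n)).symm

/-- `Ext(N₁^a, N₂^a) ≅ Ext(N₁, N₂) ⊕ Ext(N₁^a, Hom(g^↓, N₂)^s)[-1]`. -/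
def asymExtEquiv (N₁ N₂ : LieMod k (GLie k g)) (n : ℕ) :
    Ext ((asym k g).obj N₁) ((asym k g).obj N₂) n ≃ₗ[k]
      Ext N₁ N₂ n ×
        ExtPred ((asym k g).obj N₁) ((sym k g).obj ((homRight (gDown k g)).obj N₂)) n :=
  (LinearEquiv.ofBijective _ (bijective_asym_coprod_rextClass N₁ N₂ n)).symm

lemma symExtEquiv_symm_apply (N₁ N₂ : LieMod k (GLie k g)) (n : ℕ)
    (q : Ext N₁ N₂ n ×
      ExtPred ((asym k g).obj ((tensorRight (gDown k g)).obj N₁)) ((sym k g).obj N₂) n) :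
    (symExtEquiv N₁ N₂ n).symm q =
      q.1.mapExactFunctor (sym k g) + yonedaLeft (lextClass N₁) q.2 := rfl

lemma asymExtEquiv_symm_apply (N₁ N₂ : LieMod k (GLie k g)) (n : ℕ)
    (q : Ext N₁ N₂ n ×
      ExtPred ((asym k g).obj N₁) ((sym k g).obj ((homRight (gDown k g)).obj N₂)) n) :
    (asymExtEquiv N₁ N₂ n).symm q =
      q.1.mapExactFunctor (asym k g) + yonedaRight (rextClass N₂) q.2 := rfl

/-- Naturality is checked on the inverse, a sum of two explicit maps: the first is natural because
`sym` is a functor, the second because `f` induces a morphism of the extensions `lext`. -/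
lemma symExtEquiv_extMap {N₁ N₁' N₂ N₂' : LieMod k (GLie k g)} (f : N₁' ⟶ N₁) (h : N₂ ⟶ N₂')
    (n : ℕ) (ξ : Ext ((sym k g).obj N₁) ((sym k g).obj N₂) n) :
    symExtEquiv N₁' N₂' n (extMap ((sym k g).map f) ((sym k g).map h) ξ) =
      (extMap f h (symExtEquiv N₁ N₂ n ξ).1,
        extPredMap ((asym k g).map ((tensorRight (gDown k g)).map f)) ((sym k g).map h)
          (symExtEquiv N₁ N₂ n ξ).2) := by
  obtain ⟨q, rfl⟩ := (symExtEquiv N₁ N₂ n).symm.surjective ξ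
  rw [← LinearEquiv.eq_symm_apply, LinearEquiv.apply_symm_apply, symExtEquiv_symm_apply,
    symExtEquiv_symm_apply, extMap_add, mapExactFunctor_extMap,
    yonedaLeft_extPredMap (lextClass_naturality f)]

/-- As for `sym`, except that the extension now varies with the second argument, through `h`. -/
lemma asymExtEquiv_extMap {N₁ N₁' N₂ N₂' : LieMod k (GLie k g)} (f : N₁' ⟶ N₁) (h : N₂ ⟶ N₂')
    (n : ℕ) (ξ : Ext ((asym k g).obj N₁) ((asym k g).obj N₂) n) :
    asymExtEquiv N₁' N₂' n (extMap ((asym k g).map f) ((asym k g).map h) ξ) =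
      (extMap f h (asymExtEquiv N₁ N₂ n ξ).1,
        extPredMap ((asym k g).map f) ((sym k g).map ((homRight (gDown k g)).map h))
          (asymExtEquiv N₁ N₂ n ξ).2) := by
  obtain ⟨q, rfl⟩ := (asymExtEquiv N₁ N₂ n).symm.surjective ξ
  rw [← LinearEquiv.eq_symm_apply, LinearEquiv.apply_symm_apply, asymExtEquiv_symm_apply,
    asymExtEquiv_symm_apply, extMap_add, mapExactFunctor_extMap,
    yonedaRight_extPredMap (rextClass_naturality h)]

lemma symExtEquiv_symm_inl (N₁ N₂ : LieMod k (GLie k g)) (n : ℕ) (α : Ext N₁ N₂ n) :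
    (symExtEquiv N₁ N₂ n).symm (α, 0) = α.mapExactFunctor (sym k g) := by
  rw [symExtEquiv_symm_apply]
  exact (congrArg _ (map_zero (yonedaLeftLinear k (lextClass N₁) _ n))).trans (add_zero _)

lemma asymExtEquiv_symm_inl (N₁ N₂ : LieMod k (GLie k g)) (n : ℕ) (α : Ext N₁ N₂ n) :
    (asymExtEquiv N₁ N₂ n).symm (α, 0) = α.mapExactFunctor (asym k g) := by
  rw [asymExtEquiv_symm_apply]
  exact (congrArg _ (map_zero (yonedaRightLinear k (rextClass N₂) _ n))).trans (add_zero _)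

lemma symExtEquiv_symm_inr (N₁ N₂ : LieMod k (GLie k g)) (n : ℕ)
    (β : ExtPred ((asym k g).obj ((tensorRight (gDown k g)).obj N₁)) ((sym k g).obj N₂) n) :
    (symExtEquiv N₁ N₂ n).symm (0, β) = yonedaLeft (lextClass N₁) β := by
  rw [symExtEquiv_symm_apply, Ext.mapExactFunctor_zero, zero_add]

lemma asymExtEquiv_symm_inr (N₁ N₂ : LieMod k (GLie k g)) (n : ℕ)
    (β : ExtPred ((asym k g).obj N₁) ((sym k g).obj ((homRight (gDown k g)).obj N₂)) n) :
    (asymExtEquiv N₁ N₂ n).symm (0, β) = yonedaRight (rextClass N₂) β := by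
  rw [asymExtEquiv_symm_apply, Ext.mapExactFunctor_zero, zero_add]

end Decomposition

end

end Leibniz

theorem theorem7p2 (k g : Type u) [Field k] [NonUnitalNonAssocRing g] [Module k g]
    [IsScalarTower k g g] [SMulCommClass k g g] [Leibniz.IsLeibniz g] :
    (∃ Φ : ∀ (N₁ N₂ : Leibniz.LieMod k (Leibniz.GLie k g)) (n : ℕ),
        Abelian.Ext ((Leibniz.sym k g).obj N₁) ((Leibniz.sym k g).obj N₂) n ≃ₗ[k]
          Abelian.Ext N₁ N₂ n ×
            Leibniz.ExtPred
              ((Leibniz.asym k g).obj ((Leibniz.tensorRight (Leibniz.gDown k g)).obj N₁))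
              ((Leibniz.sym k g).obj N₂) n,
      (∀ (N₁ N₁' N₂ N₂' : Leibniz.LieMod k (Leibniz.GLie k g)) (f : N₁' ⟶ N₁) (h : N₂ ⟶ N₂')
          (n : ℕ) (ξ : Abelian.Ext ((Leibniz.sym k g).obj N₁) ((Leibniz.sym k g).obj N₂) n),
        Φ N₁' N₂' n (Leibniz.extMap ((Leibniz.sym k g).map f) ((Leibniz.sym k g).map h) ξ) =
          (Leibniz.extMap f h (Φ N₁ N₂ n ξ).1,
            Leibniz.extPredMap
              ((Leibniz.asym k g).map ((Leibniz.tensorRight (Leibniz.gDown k g)).map f))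
              ((Leibniz.sym k g).map h) (Φ N₁ N₂ n ξ).2)) ∧
      (∀ (N₁ N₂ : Leibniz.LieMod k (Leibniz.GLie k g)) (n : ℕ) (α : Abelian.Ext N₁ N₂ n),
        (Φ N₁ N₂ n).symm (α, 0) = α.mapExactFunctor (Leibniz.sym k g)) ∧
      (∀ (N₁ N₂ : Leibniz.LieMod k (Leibniz.GLie k g)) (n : ℕ)
          (β : Leibniz.ExtPred
            ((Leibniz.asym k g).obj ((Leibniz.tensorRight (Leibniz.gDown k g)).obj N₁))
            ((Leibniz.sym k g).obj N₂) n),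
        (Φ N₁ N₂ n).symm (0, β) = Leibniz.yonedaLeft (Leibniz.lextClass N₁) β)) ∧
    (∃ Ψ : ∀ (N₁ N₂ : Leibniz.LieMod k (Leibniz.GLie k g)) (n : ℕ),
        Abelian.Ext ((Leibniz.asym k g).obj N₁) ((Leibniz.asym k g).obj N₂) n ≃ₗ[k]
          Abelian.Ext N₁ N₂ n ×
            Leibniz.ExtPred
              ((Leibniz.asym k g).obj N₁)
              ((Leibniz.sym k g).obj ((Leibniz.homRight (Leibniz.gDown k g)).obj N₂)) n,
      (∀ (N₁ N₁' N₂ N₂' : Leibniz.LieMod k (Leibniz.GLie k g)) (f : N₁' ⟶ N₁) (h : N₂ ⟶ N₂')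
          (n : ℕ) (ξ : Abelian.Ext ((Leibniz.asym k g).obj N₁) ((Leibniz.asym k g).obj N₂) n),
        Ψ N₁' N₂' n (Leibniz.extMap ((Leibniz.asym k g).map f) ((Leibniz.asym k g).map h) ξ) =
          (Leibniz.extMap f h (Ψ N₁ N₂ n ξ).1,
            Leibniz.extPredMap
              ((Leibniz.asym k g).map f)
              ((Leibniz.sym k g).map ((Leibniz.homRight (Leibniz.gDown k g)).map h))
              (Ψ N₁ N₂ n ξ).2)) ∧
      (∀ (N₁ N₂ : Leibniz.LieMod k (Leibniz.GLie k g)) (n : ℕ) (α : Abelian.Ext N₁ N₂ n),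
        (Ψ N₁ N₂ n).symm (α, 0) = α.mapExactFunctor (Leibniz.asym k g)) ∧
      (∀ (N₁ N₂ : Leibniz.LieMod k (Leibniz.GLie k g)) (n : ℕ)
          (β : Leibniz.ExtPred ((Leibniz.asym k g).obj N₁)
            ((Leibniz.sym k g).obj ((Leibniz.homRight (Leibniz.gDown k g)).obj N₂)) n),
        (Ψ N₁ N₂ n).symm (0, β) = Leibniz.yonedaRight (Leibniz.rextClass N₂) β)) := by
  exact ⟨⟨Leibniz.symExtEquiv, fun _ _ _ _ f h n ξ => Leibniz.symExtEquiv_extMap f h n ξ,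
      Leibniz.symExtEquiv_symm_inl, Leibniz.symExtEquiv_symm_inr⟩,
    ⟨Leibniz.asymExtEquiv, fun _ _ _ _ f h n ξ => Leibniz.asymExtEquiv_extMap f h n ξ,
      Leibniz.asymExtEquiv_symm_inl, Leibniz.asymExtEquiv_symm_inr⟩⟩
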